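/- **Setting.** For $N\ge1$ let $\Omega_N=\{0,1\}^{\{0,\dots,N\}}$. Fix $p\in(\tfrac12,1]$, rates $c^\pm_{\rm in},c^\pm_{\rm out}\ge0$, and numbers $\sigma_N\ge0$ with $\sigma_N\to\infty$ and $\sigma_N/N\to0$. Let $V\in\mathcal C^1((0,1))$ be positive with $V(x)\to+\infty$ as $x\to0+$ and as $x\to1-$, and let $\rho\in\mathcal C^1([0,1];(0,1))$ have a Lipschitz continuous derivative. Put $V_i=V(i/N)$, $\rho_i=\rho(i/N)$ for $1\le i\le N-1$. Let $\eta^N=(\eta^N(t))_{t\ge0}$ be the càdlàg Markov process on $\Omega_N$, with an arbitrary initial distribution $\mu_N$ and law $\mathbb P_{\mu_N}$, generated by $L_N=N(L_{\rm exc}+L_{\rm G}+L_{\rm bd})$, where $$L_{\rm exc}f(\eta)=\sum_{i=0}^{N-1}\Big(p\,\eta_i(1-\eta_{i+1})+(1-p)\,\eta_{i+1}(1-\eta_i)+\tfrac{\sigma_N}2\Big)\big[f(\eta^{i,i+1})-f(\eta)\big],$$ $$L_{\rm G}f(\eta)=\frac1N\sum_{i=1}^{N-1}V_i\big[\rho_i(1-\eta_i)+(1-\rho_i)\eta_i\big]\big[f(\eta^i)-f(\eta)\big],$$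 $$L_{\rm bd}f(\eta)=\big[c^-_{\rm in}(1-\eta_0)+c^-_{\rm out}\eta_0\big]\big[f(\eta^0)-f(\eta)\big]+\big[c^+_{\rm in}(1-\eta_N)+c^+_{\rm out}\eta_N\big]\big[f(\eta^N)-f(\eta)\big];$$ here $\eta^{i,i+1}$ is $\eta$ with the values at $i$ and $i+1$ swapped, and $\eta^i$ (also for $i=0,N$) is $\eta$ with the value at $i$ flipped. **Proposition 2.3.** (Left boundary.) If $\displaystyle\lim_{y\to0+}\Big\{y\inf_{x\in(0,y)}V(x)\Big\}=\infty$, then for every $t>0$ and every $\delta>0$, $$\lim_{y\to0+}\ \limsup_{N\to\infty}\ \mathbb P_{\mu_N}\left\{\left|\int_0^t\frac1{yN}\sum_{i=0}^{\lfloor yN\rfloor}\eta^N_i(s)\,ds-t\rho(0)\right|>\delta\right\}=0 .$$ (Right boundary.) If $\displaystyle\lim_{y\to0+}\Big\{y\inf_{x\in(1-y,1)}V(x)\Big\}=\infty$, then for every $t>0$ and every $\delta>0$, $$\lim_{y\to0+}\ \limsup_{N\to\infty}\ \mathbb P_{\mu_N}\left\{\left|\int_0^t\frac1{yN}\sum_{i=N-\lfloor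 yN\rfloor}^{N}\eta^N_i(s)\,ds-t\rho(1)\right|>\delta\right\}=0 .$$ -/

import Mathlib

open Filter Set MeasureTheory
open scoped NNReal Topology

namespace OpenASEP

/-- Configurations `η = (η_i)_{0 ≤ i ≤ N}` with `η_i ∈ {0, 1}`; `true` means that the site is
occupied. The topology and the σ-algebra are the discrete ones. -/
abbrev Config (N : ℕ) : Type := Fin (N + 1) → Bool

noncomputable section

/-- The occupation variable `η_i`, as a real number. -/
def occ {N : ℕ} (η : Config N) (i : Fin (N + 1)) : ℝ := if η i then 1 else 0

/-- The configuration with the values at the sites `i` and `j` swapped. -/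
def swapSites {N : ℕ} (η : Config N) (i j : Fin (N + 1)) : Config N := η ∘ Equiv.swap i j

/-- The configuration with the value at the site `i` flipped. -/
def flipSite {N : ℕ} (η : Config N) (i : Fin (N + 1)) : Config N := Function.update η i (!η i)

/-- The asymmetric jump rate
`c_{i,j}(η) = p η_i (1 - η_j) + (1 - p) η_j (1 - η_i)`, used for `j = i + 1`. -/
def excRate {N : ℕ} (p : ℝ) (η : Config N) (i j : Fin (N + 1)) : ℝ :=
  p * occ η i * (1 - occ η j) + (1 - p) * occ η j * (1 - occ η i)

/-- The exclusion generator
`∑_{i=0}^{N-1} (c_{i,i+1}(η) + σ/2) (f(η^{i,i+1}) - f(η))`. -/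
def excGen {N : ℕ} (p σ : ℝ) (f : Config N → ℝ) (η : Config N) : ℝ :=
  ∑ i : Fin N, (excRate p η i.castSucc i.succ + σ / 2) *
    (f (swapSites η i.castSucc i.succ) - f η)

/-- The Glauber rate `V(i/N) (ρ(i/N) (1 - η_i) + (1 - ρ(i/N)) η_i)`. -/
def glauberRate {N : ℕ} (V ρ : ℝ → ℝ) (η : Config N) (i : Fin (N + 1)) : ℝ :=
  V (((i : ℕ) : ℝ) / N) *
    (ρ (((i : ℕ) : ℝ) / N) * (1 - occ η i) + (1 - ρ (((i : ℕ) : ℝ) / N)) * occ η i)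

/-- The Glauber generator
`(1/N) ∑_{i=1}^{N-1} c_{i,G}(η) (f(η^i) - f(η))`. -/
def glauberGen {N : ℕ} (V ρ : ℝ → ℝ) (f : Config N → ℝ) (η : Config N) : ℝ :=
  (1 / (N : ℝ)) * ∑ i ∈ Finset.univ.filter (fun i : Fin (N + 1) => 0 < (i : ℕ) ∧ (i : ℕ) < N),
    glauberRate V ρ η i * (f (flipSite η i) - f η)

/-- The birth-and-death generator of the reservoirs at the sites `0` and `N`; `a₀, b₀` are the
rates of creation and annihilation at `0`, and `a₁, b₁` those at `N`. -/
def bdGen {N : ℕ} (a₀ b₀ a₁ b₁ : ℝ) (f : Config N → ℝ) (η : Config N) : ℝ :=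
  (a₀ * (1 - occ η 0) + b₀ * occ η 0) * (f (flipSite η 0) - f η) +
    (a₁ * (1 - occ η (Fin.last N)) + b₁ * occ η (Fin.last N)) *
      (f (flipSite η (Fin.last N)) - f η)

/-- The full generator `L_N = N (L_exc + L_G + L_bd)`. -/
def gen (N : ℕ) (p σ : ℝ) (V ρ : ℝ → ℝ) (a₀ b₀ a₁ b₁ : ℝ)
    (f : Config N → ℝ) (η : Config N) : ℝ :=
  N * (excGen p σ f η + glauberGen V ρ f η + bdGen a₀ b₀ a₁ b₁ f η)

/-- The matrix of an operator `L` on functions of the configuration: its `(η, ξ)` entry is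
`(L 1_{ξ})(η)`, for a generator the rate of the jumps from `η` to `ξ` when `ξ ≠ η`. -/
def toRateMatrix {N : ℕ} (L : (Config N → ℝ) → Config N → ℝ) :
    Matrix (Config N) (Config N) ℝ :=
  fun η ξ => L (Pi.single ξ 1) η

/-- `X` is, under `P`, a càdlàg continuous-time Markov chain with generator `L` and initial
distribution `μ`: its finite-dimensional distributions are those given by `μ` and the transition
probabilities `exp (t L)`. -/
structure IsMarkovProcess {N : ℕ} {Ω : Type*} [MeasurableSpace Ω]
    (L : (Config N → ℝ) → Config N → ℝ) (μ : Measure (Config N))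
    (P : Measure Ω) (X : ℝ≥0 → Ω → Config N) : Prop where
  measurable : ∀ t, Measurable (X t)
  right_continuous : ∀ ω t, ContinuousWithinAt (fun s => X s ω) (Ici t) t
  left_limits : ∀ ω t, ∃ ξ, Tendsto (fun s => X s ω) (𝓝[<] t) (𝓝 ξ)
  fin_dim : ∀ (n : ℕ) (τ : ℕ → ℝ≥0) (ξ : ℕ → Config N), Monotone τ → τ 0 = 0 →
    P.real {ω | ∀ k ≤ n, X (τ k) ω = ξ k} =
      μ.real {ξ 0} * ∏ k ∈ Finset.range n,
        NormedSpace.exp (((τ (k + 1) : ℝ) - (τ k : ℝ)) • toRateMatrix L) (ξ k) (ξ (k + 1))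

/-- `(1/(yN)) ∑_{i=0}^{⌊yN⌋} η_i`, the density of the leftmost `y`-fraction of the sites. -/
def leftDensity {N : ℕ} (y : ℝ) (η : Config N) : ℝ :=
  1 / (y * N) * ∑ i ∈ Finset.univ.filter (fun i : Fin (N + 1) => (i : ℕ) ≤ ⌊y * N⌋₊), occ η i

/-- `(1/(yN)) ∑_{i=N-⌊yN⌋}^{N} η_i`, the density of the rightmost `y`-fraction of the sites. -/
def rightDensity {N : ℕ} (y : ℝ) (η : Config N) : ℝ :=
  1 / (y * N) * ∑ i ∈ Finset.univ.filter (fun i : Fin (N + 1) => N ≤ (i : ℕ) + ⌊y * N⌋₊), occ η i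

end

end OpenASEP

namespace OpenASEP

noncomputable section

/-! ### Elementary logarithmic inequalities -/

/-! This is an entropy estimate. Let `H` be the relative entropy of the law at time `s` with respect
to the product of Bernoulli laws with means `ρ(i/N)`. The Glauber part is reversible for this
reference measure. Since its factor `1/N` cancels the time scale `N`, it dissipates at least `∑ V_i
D_i`, where `D_i` (`flipDissipation`) measures how far the law is from equilibrium under resampling
at `i`.

Everything else produces only `O(N + σ_N)` (`sum_gen_logDensity_le`). In the asymmetric exclusion
the current terms telescope along the lattice, and the slope of `log ρ` costs `O(1/N)` per bond. In
the symmetric exclusion the cost per bond is quadratic in this slope. Each reservoir costs `O(1)`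
before the time scaling. As `H` has order `N` at both ends of `[0, t]`, the time integral of `∑ V_i
D_i` is `O(N)` once `σ_N = O(N)`.

Conversely, small dissipation decorrelates the sites. For `|A| = n`, the second moment of `∑_{i ∈ A}
(η_i - ρ_i)` is at most `n + n (θ ∑_{i ∈ A} D_i + n / (4θ))` for every `θ > 0`
(`sum_sq_fluctuation_le`). If `V ≥ M` on the `n ≈ yN` sites next to the boundary, division by `n²`
and integration in time give a bound of order `1/n + 1/θ + θ/(yM)`. With `θ = √(yM)` it vanishes as
`N → ∞` and then `y → 0`, precisely because `yM → ∞`. Chebyshev's inequality concludes, continuity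
of `ρ` replacing `ρ_i` by its boundary value. -/

lemma mul_log_sub_log_le {a b : ℝ} (ha : 0 < a) (hb : 0 < b) :
    a * (Real.log b - Real.log a) ≤ b - a := by
  have h := Real.log_le_sub_one_of_pos (div_pos hb ha)
  rw [Real.log_div hb.ne' ha.ne'] at h
  calc a * (Real.log b - Real.log a) ≤ a * (b / a - 1) := by gcongr
    _ = b - a := by field_simp

/-- For `b ≤ a` the product can be positive only if `log a - log b < c`. Then `a - b ≤ a (log a -
log b) ≤ a c`, while the other factor is at most `c`. This makes the cost of the symmetric exchange
quadratic in the tilt `c` of the reference measure, so that the factor `σ_N` is harmless. -/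
lemma sub_mul_log_sub_log_add_le {a b : ℝ} (ha : 0 < a) (hb : 0 < b) (c : ℝ) :
    (a - b) * (Real.log b - Real.log a + c) ≤ (a + b) * c ^ 2 := by
  have key : ∀ {a b : ℝ}, 0 < a → 0 < b → b ≤ a → ∀ c : ℝ,
      (a - b) * (Real.log b - Real.log a + c) ≤ (a + b) * c ^ 2 := by
    intro a b ha hb hab c
    have h1 := mul_log_sub_log_le ha hb
    have h2 := Real.log_le_log hb hab
    rcases le_or_gt (Real.log b - Real.log a + c) 0 with h | h
    · exact (mul_nonpos_of_nonneg_of_nonpos (sub_nonneg.2 hab) h).trans (by positivity)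
    · calc (a - b) * (Real.log b - Real.log a + c) ≤
          (a * (Real.log a - Real.log b)) * (Real.log b - Real.log a + c) := by
            gcongr; linarith
        _ ≤ (a * c) * c := by
            have : 0 ≤ Real.log a - Real.log b := by linarith
            gcongr <;> nlinarith
        _ ≤ (a + b) * c ^ 2 := by nlinarith [mul_nonneg hb.le (sq_nonneg c)]
  rcases le_total b a with h | h
  · exact key ha hb h c
  · have := key hb ha h (-c)
    nlinarith

lemma sub_mul_log_sub_log_le {a b : ℝ} (ha : 0 < a) (hb : 0 < b) :
    (a - b) * (Real.log b - Real.log a) ≤ -((a - b) ^ 2 / (a + b)) := by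
  have key : ∀ {a b : ℝ}, 0 < a → 0 < b → b ≤ a →
      (a - b) * (Real.log b - Real.log a) ≤ -((a - b) ^ 2 / (a + b)) := by
    intro a b ha hb hab
    have h1 := mul_log_sub_log_le ha hb
    rw [← neg_le_neg_iff, neg_neg, div_le_iff₀ (by positivity)]
    have h2 : 0 ≤ Real.log a - Real.log b := sub_nonneg.2 (Real.log_le_log hb hab)
    have h3 : 0 ≤ (a - b) * (a * (Real.log a - Real.log b) - (a - b)) :=
      mul_nonneg (sub_nonneg.2 hab) (by linarith)
    have h4 : 0 ≤ (a - b) * (b * (Real.log a - Real.log b)) :=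
      mul_nonneg (sub_nonneg.2 hab) (by positivity)
    nlinarith
  rcases le_total b a with h | h
  · exact key ha hb h
  · have := key hb ha h
    rw [add_comm b a, ← neg_sub a b, neg_sq] at this
    linarith

/-- Young's inequality: the difference of the two sides is a perfect square over a positive
denominator. The free parameter `θ` is kept for the final optimization. -/
lemma abs_sub_le_dissipation {a b θ : ℝ} (ha : 0 < a) (hb : 0 < b) (hθ : 0 < θ) :
    |a - b| ≤ θ * ((a - b) ^ 2 / (a + b)) + (a + b) / (4 * θ) := by
  have hs : 0 < a + b := by positivity
  have : θ * ((a - b) ^ 2 / (a + b)) + (a + b) / (4 * θ) - |a - b| =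
      (2 * θ * |a - b| - (a + b)) ^ 2 / (4 * θ * (a + b)) := by
    rw [← sq_abs (a - b)]
    field_simp
    ring
  have h2 : 0 ≤ (2 * θ * |a - b| - (a + b)) ^ 2 / (4 * θ * (a + b)) := by positivity
  linarith

/-! ### Sums over configurations -/

variable {N : ℕ}

lemma sum_comp_involutive {α : Type*} [Fintype α] {T : α → α} (hT : Function.Involutive T)
    (F : α → ℝ) : ∑ η, F (T η) = ∑ η, F η :=
  Equiv.sum_comp hT.toPerm F

/-- The sum is averaged with its image under `T`, as for the Dirichlet form of a reversible
dynamics. -/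
lemma sum_mul_sub_involutive {α : Type*} [Fintype α] {T : α → α} (hT : Function.Involutive T)
    (m u : α → ℝ) :
    ∑ η, m η * (u (T η) - u η) = 1 / 2 * ∑ η, (m η - m (T η)) * (u (T η) - u η) := by
  have h := sum_comp_involutive hT (fun η => m η * (u (T η) - u η))
  simp only [hT _] at h
  have h2 : ∑ η, (m η - m (T η)) * (u (T η) - u η) =
      ∑ η, m η * (u (T η) - u η) + ∑ η, m (T η) * (u η - u (T η)) := by
    rw [← Finset.sum_add_distrib]
    exact Finset.sum_congr rfl fun η _ => by ring
  rw [h2, h]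
  ring

lemma swapSites_involutive (i j : Fin (N + 1)) :
    Function.Involutive fun η : Config N => swapSites η i j := by
  intro η
  ext k
  simp [swapSites]

lemma flipSite_involutive (i : Fin (N + 1)) :
    Function.Involutive fun η : Config N => flipSite η i := by
  intro η
  simp [flipSite]

lemma occ_nonneg (η : Config N) (i : Fin (N + 1)) : 0 ≤ occ η i := by
  unfold occ; split_ifs <;> norm_num

lemma occ_le_one (η : Config N) (i : Fin (N + 1)) : occ η i ≤ 1 := by
  unfold occ; split_ifs <;> norm_num

lemma occ_swapSites_left (η : Config N) (i j : Fin (N + 1)) :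
    occ (swapSites η i j) i = occ η j := by simp [occ, swapSites]

lemma occ_swapSites_right (η : Config N) (i j : Fin (N + 1)) :
    occ (swapSites η i j) j = occ η i := by simp [occ, swapSites]

lemma excRate_nonneg {p : ℝ} (hp : 0 ≤ p) (hp' : p ≤ 1) (η : Config N) (i j : Fin (N + 1)) :
    0 ≤ excRate p η i j := by
  have := occ_nonneg η i
  have := occ_nonneg η j
  have := sub_nonneg.2 (occ_le_one η i)
  have := sub_nonneg.2 (occ_le_one η j)
  have := sub_nonneg.2 hp'
  unfold excRate
  positivity

lemma excRate_le_one {p : ℝ} (hp : 0 ≤ p) (hp' : p ≤ 1) (η : Config N) (i j : Fin (N + 1)) :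
    excRate p η i j ≤ 1 := by
  unfold excRate occ
  split_ifs <;> linarith

lemma excRate_swapSites_sub (p : ℝ) (η : Config N) (i j : Fin (N + 1)) :
    excRate p (swapSites η i j) i j - excRate p η i j = (2 * p - 1) * (occ η j - occ η i) := by
  simp only [excRate, occ_swapSites_left, occ_swapSites_right]
  ring

/-! ### The reference measure -/

/-- The weight of the value `b` under the Bernoulli law with mean `r`. -/
def siteProb (r : ℝ) (b : Bool) : ℝ := if b then r else 1 - r

/-- The logarithm of the weight of `η` under the product of the Bernoulli laws with means `r i`. -/
def logRef (r : Fin (N + 1) → ℝ) (η : Config N) : ℝ := ∑ i, Real.log (siteProb (r i) (η i))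

lemma siteProb_pos {r : ℝ} (hr : r ∈ Ioo (0 : ℝ) 1) (b : Bool) : 0 < siteProb r b := by
  unfold siteProb
  split_ifs
  · exact hr.1
  · linarith [hr.2]

lemma siteProb_le_one {r : ℝ} (hr : r ∈ Ioo (0 : ℝ) 1) (b : Bool) : siteProb r b ≤ 1 := by
  unfold siteProb
  split_ifs
  · exact hr.2.le
  · linarith [hr.1]

lemma logRef_flipSite_sub (r : Fin (N + 1) → ℝ) (η : Config N) (i : Fin (N + 1)) :
    logRef r (flipSite η i) - logRef r η =
      Real.log (siteProb (r i) (!η i)) - Real.log (siteProb (r i) (η i)) := by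
  unfold logRef
  rw [← Finset.sum_sub_distrib, Finset.sum_eq_single i]
  · simp [flipSite]
  · intro k _ hk
    simp [flipSite, hk]
  · simp

lemma abs_logRef_swapSites_sub_le (r : Fin (N + 1) → ℝ) (η : Config N) {i j : Fin (N + 1)}
    (hij : i ≠ j) {κ : ℝ}
    (hκ : ∀ b, |Real.log (siteProb (r i) b) - Real.log (siteProb (r j) b)| ≤ κ) :
    |logRef r (swapSites η i j) - logRef r η| ≤ 2 * κ := by
  have : logRef r (swapSites η i j) - logRef r η =
      (Real.log (siteProb (r i) (η j)) - Real.log (siteProb (r j) (η j))) -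
      (Real.log (siteProb (r i) (η i)) - Real.log (siteProb (r j) (η i))) := by
    unfold logRef
    rw [← Finset.sum_sub_distrib, Fintype.sum_eq_add i j hij]
    · simp only [swapSites, Function.comp_apply, Equiv.swap_apply_left, Equiv.swap_apply_right]
      ring
    · rintro k ⟨hki, hkj⟩
      simp [swapSites, Equiv.swap_apply_of_ne_of_ne hki hkj]
  rw [this]
  exact (abs_sub _ _).trans (by linarith [hκ (η i), hκ (η j)])

/-! ### Entropy production -/

/-- The logarithm of the density of `m` with respect to the reference measure. -/
def logDensity (r : Fin (N + 1) → ℝ) (m : Config N → ℝ) (η : Config N) : ℝ :=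
  Real.log (m η) - logRef r η

lemma sum_swap_logDensity_le (r : Fin (N + 1) → ℝ) {m : Config N → ℝ} (hm : ∀ η, 0 < m η)
    (hm1 : ∑ η, m η = 1) {i j : Fin (N + 1)} (hij : i ≠ j) {κ : ℝ}
    (hκ : ∀ b, |Real.log (siteProb (r i) b) - Real.log (siteProb (r j) b)| ≤ κ) :
    ∑ η, m η * (logDensity r m (swapSites η i j) - logDensity r m η) ≤ 4 * κ ^ 2 := by
  have hT := swapSites_involutive (N := N) i j
  rw [sum_mul_sub_involutive hT]
  have h1 : ∀ η : Config N, (m η - m (swapSites η i j)) *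
      (logDensity r m (swapSites η i j) - logDensity r m η) ≤
      (m η + m (swapSites η i j)) * (2 * κ) ^ 2 := by
    intro η
    have h2 := abs_logRef_swapSites_sub_le r η hij hκ
    have h3 := sub_mul_log_sub_log_add_le (hm η) (hm (swapSites η i j))
      (-(logRef r (swapSites η i j) - logRef r η))
    calc _ = _ := by unfold logDensity; ring
      _ ≤ _ := h3
      _ ≤ _ := by
        have := (hm η).le
        have := (hm (swapSites η i j)).le
        rw [neg_sq]
        gcongr ?_ * ?_
        exact sq_le_sq' (by linarith [abs_le.1 h2]) (abs_le.1 h2).2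
  have h4 := Finset.sum_le_sum fun η (_ : η ∈ Finset.univ) => h1 η
  rw [← Finset.sum_mul, Finset.sum_add_distrib, sum_comp_involutive hT m, hm1] at h4
  linarith

/-- The asymmetric exchange is not reversible, so there is no symmetrization. The bound `m (log m' -
log m) ≤ m' - m` leaves the mean change of the jump rate under the swap, which is a discrete
gradient and telescopes over the bonds. The tilt of the reference measure enters only linearly. -/
lemma sum_excRate_logDensity_le {p : ℝ} (hp : 0 ≤ p) (hp' : p ≤ 1) (r : Fin (N + 1) → ℝ)
    {m : Config N → ℝ} (hm : ∀ η, 0 < m η) (hm1 : ∑ η, m η = 1) {i j : Fin (N + 1)}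
    (hij : i ≠ j) {κ : ℝ}
    (hκ : ∀ b, |Real.log (siteProb (r i) b) - Real.log (siteProb (r j) b)| ≤ κ) :
    ∑ η, m η * (excRate p η i j * (logDensity r m (swapSites η i j) - logDensity r m η)) ≤
      ∑ η, m η * ((2 * p - 1) * (occ η j - occ η i)) + 2 * κ := by
  have hT := swapSites_involutive (N := N) i j
  have h1 : ∀ η : Config N, m η * (excRate p η i j *
      (logDensity r m (swapSites η i j) - logDensity r m η)) ≤
      excRate p η i j * (m (swapSites η i j) - m η) + m η * (2 * κ) := by
    intro η
    have h2 := abs_logRef_swapSites_sub_le r η hij hκ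
    have h3 := mul_log_sub_log_le (hm η) (hm (swapSites η i j))
    have h4 := excRate_nonneg hp hp' η i j
    have h5 := excRate_le_one hp hp' η i j
    have h6 : m η * (excRate p η i j * -(logRef r (swapSites η i j) - logRef r η)) ≤
        m η * (1 * (2 * κ)) := by
      refine mul_le_mul_of_nonneg_left ?_ (hm η).le
      refine mul_le_mul_of_nonneg h5 (by linarith [abs_le.1 h2]) h4 ?_
      exact (abs_nonneg _).trans h2
    have h7 := mul_le_mul_of_nonneg_left h3 h4
    unfold logDensity
    linarith
  have h8 := Finset.sum_le_sum fun η (_ : η ∈ Finset.univ) => h1 η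
  rw [Finset.sum_add_distrib, ← Finset.sum_mul, hm1, one_mul] at h8
  refine h8.trans_eq ?_
  congr 1
  -- The change of variables moves the swap from `m` to the rate.
  have h9 := sum_comp_involutive hT (fun η => excRate p η i j * m (swapSites η i j))
  simp only [hT _] at h9
  simp only [mul_sub, Finset.sum_sub_distrib]
  rw [← h9, ← Finset.sum_sub_distrib, ← Finset.sum_sub_distrib]
  refine Finset.sum_congr rfl fun η _ => ?_
  rw [← sub_mul, excRate_swapSites_sub]
  ring

lemma sum_excGen_logDensity_le {p σ : ℝ} (hp : 1 / 2 ≤ p) (hp' : p ≤ 1) (hσ : 0 ≤ σ)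
    (r : Fin (N + 1) → ℝ)
    {m : Config N → ℝ} (hm : ∀ η, 0 < m η) (hm1 : ∑ η, m η = 1) {κ : ℝ}
    (hκ : ∀ (i : Fin N) b, |Real.log (siteProb (r i.castSucc) b) -
      Real.log (siteProb (r i.succ) b)| ≤ κ) :
    ∑ η, m η * excGen p σ (logDensity r m) η ≤ 1 + N * (2 * κ) + N * (2 * σ * κ ^ 2) := by
  have h1 : ∑ η, m η * excGen p σ (logDensity r m) η = ∑ i : Fin N,
      (∑ η, m η * (excRate p η i.castSucc i.succ *
        (logDensity r m (swapSites η i.castSucc i.succ) - logDensity r m η)) +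
      σ / 2 * ∑ η, m η *
        (logDensity r m (swapSites η i.castSucc i.succ) - logDensity r m η)) := by
    simp only [excGen, Finset.mul_sum]
    rw [Finset.sum_comm]
    refine Finset.sum_congr rfl fun i _ => ?_
    rw [← Finset.sum_add_distrib]
    exact Finset.sum_congr rfl fun η _ => by ring
  have hne : ∀ i : Fin N, i.castSucc ≠ i.succ := fun i => (Fin.castSucc_lt_succ).ne
  have h2 : ∑ η, m η * excGen p σ (logDensity r m) η ≤ ∑ i : Fin N,
      (∑ η, m η * ((2 * p - 1) * (occ η i.succ - occ η i.castSucc)) + 2 * κ +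
        σ / 2 * (4 * κ ^ 2)) := by
    rw [h1]
    refine Finset.sum_le_sum fun i _ => add_le_add ?_ ?_
    · exact sum_excRate_logDensity_le (by linarith) hp' r hm hm1 (hne i) (hκ i)
    · exact mul_le_mul_of_nonneg_left (sum_swap_logDensity_le r hm hm1 (hne i) (hκ i))
        (by positivity)
  refine h2.trans ?_
  -- The gradients telescope to `occ η (Fin.last N) - occ η 0`, so the asymmetry costs `O(1)` in
  -- total, not per bond.
  have h3 : ∑ i : Fin N, ∑ η, m η * ((2 * p - 1) * (occ η i.succ - occ η i.castSucc)) ≤ 1 := by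
    rw [Finset.sum_comm, ← hm1]
    refine Finset.sum_le_sum fun η _ => ?_
    rw [← Finset.mul_sum, ← Finset.mul_sum]
    have : ∑ i : Fin N, (occ η i.succ - occ η i.castSucc) = occ η (Fin.last N) - occ η 0 := by
      have a1 := Fin.sum_univ_succ (occ η)
      have a2 := Fin.sum_univ_castSucc (occ η)
      rw [Finset.sum_sub_distrib]
      linarith
    rw [this]
    refine mul_le_of_le_one_right (hm η).le ?_
    have := occ_nonneg η 0
    have := occ_le_one η (Fin.last N)
    nlinarith
  simp only [Finset.sum_add_distrib, Finset.sum_const, Finset.card_univ, Fintype.card_fin,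
    nsmul_eq_mul]
  linarith

/-- The reservoirs need not be reversible for the reference measure; a crude bound suffices as there
are only two of them. The law contributes at most `m'` and the reference weight at most `K`, at a
rate of at most `a + b`. -/
lemma sum_flip_logDensity_le {r : Fin (N + 1) → ℝ} (hr : ∀ i, r i ∈ Ioo (0 : ℝ) 1)
    {m : Config N → ℝ} (hm : ∀ η, 0 < m η) (hm1 : ∑ η, m η = 1) (i : Fin (N + 1))
    {a b K : ℝ} (ha : 0 ≤ a) (hb : 0 ≤ b)
    (hK : ∀ b, -K ≤ Real.log (siteProb (r i) b)) :
    ∑ η, m η * ((a * (1 - occ η i) + b * occ η i) *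
      (logDensity r m (flipSite η i) - logDensity r m η)) ≤ (a + b) * (1 + K) := by
  have hT := flipSite_involutive (N := N) i
  have h1 : ∀ η : Config N, m η * ((a * (1 - occ η i) + b * occ η i) *
      (logDensity r m (flipSite η i) - logDensity r m η)) ≤
      (a + b) * m (flipSite η i) + m η * ((a + b) * K) := by
    intro η
    have h0 := occ_nonneg η i
    have h0' := sub_nonneg.2 (occ_le_one η i)
    set R := a * (1 - occ η i) + b * occ η i with hR
    have h2 : 0 ≤ R := by positivity
    have h3 : R ≤ a + b := by nlinarith
    have h4 := mul_log_sub_log_le (hm η) (hm (flipSite η i))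
    have h5 := logRef_flipSite_sub r η i
    have h6 := Real.log_nonpos (siteProb_pos (hr i) (η i)).le (siteProb_le_one (hr i) (η i))
    have h7 := hK (!η i)
    have hK0 : 0 ≤ K := by
      have := Real.log_nonpos (siteProb_pos (hr i) (!η i)).le (siteProb_le_one (hr i) (!η i))
      linarith
    calc m η * (R * (logDensity r m (flipSite η i) - logDensity r m η)) =
        R * (m η * (Real.log (m (flipSite η i)) - Real.log (m η))) +
          m η * (R * -(logRef r (flipSite η i) - logRef r η)) := by unfold logDensity; ring
      _ ≤ R * m (flipSite η i) + m η * (R * K) := by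
          have := hm η
          gcongr <;> linarith
      _ ≤ _ := by
          have := hm η
          have := hm (flipSite η i)
          gcongr
  have h8 := Finset.sum_le_sum fun η (_ : η ∈ Finset.univ) => h1 η
  rw [Finset.sum_add_distrib, ← Finset.sum_mul, ← Finset.mul_sum, sum_comp_involutive hT m, hm1]
    at h8
  linarith

/-- The mass of `η` times the rate at which a Bernoulli resampling flips the site `i`. -/
def flipMass (r : Fin (N + 1) → ℝ) (m : Config N → ℝ) (i : Fin (N + 1)) (η : Config N) : ℝ :=
  m η * siteProb (r i) (!η i)

/-- A lower bound for the entropy dissipated by the resampling of the site `i`. -/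
def flipDissipation (r : Fin (N + 1) → ℝ) (m : Config N → ℝ) (i : Fin (N + 1)) : ℝ :=
  1 / 2 * ∑ η, (flipMass r m i η - flipMass r m i (flipSite η i)) ^ 2 /
    (flipMass r m i η + flipMass r m i (flipSite η i))

lemma flipMass_pos {r : Fin (N + 1) → ℝ} (hr : ∀ i, r i ∈ Ioo (0 : ℝ) 1)
    {m : Config N → ℝ} (hm : ∀ η, 0 < m η) (i : Fin (N + 1)) (η : Config N) :
    0 < flipMass r m i η :=
  mul_pos (hm η) (siteProb_pos (hr i) _)

lemma flipDissipation_nonneg {r : Fin (N + 1) → ℝ} (hr : ∀ i, r i ∈ Ioo (0 : ℝ) 1)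
    {m : Config N → ℝ} (hm : ∀ η, 0 < m η) (i : Fin (N + 1)) : 0 ≤ flipDissipation r m i := by
  refine mul_nonneg (by norm_num) (Finset.sum_nonneg fun η _ => ?_)
  have := flipMass_pos hr hm i η
  have := flipMass_pos hr hm i (flipSite η i)
  positivity

/-- Detailed balance turns the increment of the log-density into that of `log (flipMass r m i)`.
After symmetrization every term has a sign, and no error remains. -/
lemma sum_resample_logDensity_le {r : Fin (N + 1) → ℝ} (hr : ∀ i, r i ∈ Ioo (0 : ℝ) 1)
    {m : Config N → ℝ} (hm : ∀ η, 0 < m η) (i : Fin (N + 1)) :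
    ∑ η, m η * (siteProb (r i) (!η i) *
      (logDensity r m (flipSite η i) - logDensity r m η)) ≤ -flipDissipation r m i := by
  have hT := flipSite_involutive (N := N) i
  have h1 : ∀ η : Config N, m η * (siteProb (r i) (!η i) *
      (logDensity r m (flipSite η i) - logDensity r m η)) =
      flipMass r m i η * (Real.log (flipMass r m i (flipSite η i)) -
        Real.log (flipMass r m i η)) := by
    intro η
    have h2 := logRef_flipSite_sub r η i
    have hw := fun b => (siteProb_pos (hr i) b).ne'
    have h3 : logDensity r m (flipSite η i) - logDensity r m η =
        Real.log (flipMass r m i (flipSite η i)) - Real.log (flipMass r m i η) := by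
      unfold flipMass logDensity
      rw [Real.log_mul (hm _).ne' (hw _), Real.log_mul (hm _).ne' (hw _)]
      have : (flipSite η i) i = !η i := by simp [flipSite]
      rw [this, Bool.not_not]
      linarith
    rw [h3, ← mul_assoc]
    rfl
  rw [Finset.sum_congr rfl fun η _ => h1 η]
  rw [sum_mul_sub_involutive hT (flipMass r m i) (fun η => Real.log (flipMass r m i η)),
    flipDissipation, ← mul_neg, ← Finset.sum_neg_distrib]
  refine mul_le_mul_of_nonneg_left (Finset.sum_le_sum fun η _ => ?_) (by norm_num)
  exact sub_mul_log_sub_log_le (flipMass_pos hr hm i η) (flipMass_pos hr hm i _)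

lemma glauberRate_eq (V ρ : ℝ → ℝ) (η : Config N) (i : Fin (N + 1)) :
    glauberRate V ρ η i =
      V (((i : ℕ) : ℝ) / N) * siteProb (ρ (((i : ℕ) : ℝ) / N)) (!η i) := by
  unfold glauberRate occ siteProb
  cases η i <;> simp

/-- The sites `0 < i < N`. -/
def interior (N : ℕ) : Finset (Fin (N + 1)) :=
  Finset.univ.filter (fun i : Fin (N + 1) => 0 < (i : ℕ) ∧ (i : ℕ) < N)

/-- The values `ρ (i / N)` of a profile at the sites. -/
def profile (N : ℕ) (ρ : ℝ → ℝ) (i : Fin (N + 1)) : ℝ := ρ (((i : ℕ) : ℝ) / N)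

lemma sum_glauberGen_logDensity_le {V ρ : ℝ → ℝ}
    (hr : ∀ i, profile N ρ i ∈ Ioo (0 : ℝ) 1)
    (hV : ∀ i ∈ interior N, 0 ≤ V (((i : ℕ) : ℝ) / N))
    {m : Config N → ℝ} (hm : ∀ η, 0 < m η) :
    ∑ η, m η * glauberGen V ρ (logDensity (profile N ρ) m) η ≤
      -(1 / (N : ℝ) * ∑ i ∈ interior N,
        V (((i : ℕ) : ℝ) / N) * flipDissipation (profile N ρ) m i) := by
  have h1 : ∑ η, m η * glauberGen V ρ (logDensity (profile N ρ) m) η =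
      1 / (N : ℝ) * ∑ i ∈ interior N, V (((i : ℕ) : ℝ) / N) *
        ∑ η, m η * (siteProb (profile N ρ i) (!η i) *
          (logDensity (profile N ρ) m (flipSite η i) - logDensity (profile N ρ) m η)) := by
    simp only [glauberGen, Finset.mul_sum]
    rw [Finset.sum_comm]
    refine Finset.sum_congr rfl fun i _ => Finset.sum_congr rfl fun η _ => ?_
    rw [glauberRate_eq, profile]
    ring
  rw [h1, ← mul_neg, ← Finset.sum_neg_distrib]
  refine mul_le_mul_of_nonneg_left (Finset.sum_le_sum fun i hi => ?_) (by positivity)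
  rw [← mul_neg]
  exact mul_le_mul_of_nonneg_left (sum_resample_logDensity_le hr hm i) (hV i hi)

/-- The entropy production of the full dynamics. -/
lemma sum_gen_logDensity_le (hN : 0 < N) {p σ : ℝ} (hp : 1 / 2 ≤ p) (hp' : p ≤ 1) (hσ : 0 ≤ σ)
    {a₀ b₀ a₁ b₁ : ℝ} (ha₀ : 0 ≤ a₀) (hb₀ : 0 ≤ b₀) (ha₁ : 0 ≤ a₁) (hb₁ : 0 ≤ b₁)
    {V ρ : ℝ → ℝ} (hr : ∀ i, profile N ρ i ∈ Ioo (0 : ℝ) 1)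
    (hV : ∀ i ∈ interior N, 0 ≤ V (((i : ℕ) : ℝ) / N)) {K : ℝ}
    (hK : ∀ i b, -K ≤ Real.log (siteProb (profile N ρ i) b))
    (hκ : ∀ (i : Fin N) b, |Real.log (siteProb (profile N ρ i.castSucc) b) -
      Real.log (siteProb (profile N ρ i.succ) b)| ≤ K / N)
    {m : Config N → ℝ} (hm : ∀ η, 0 < m η) (hm1 : ∑ η, m η = 1) :
    ∑ η, m η * gen N p σ V ρ a₀ b₀ a₁ b₁ (logDensity (profile N ρ) m) η ≤
      -(∑ i ∈ interior N, V (((i : ℕ) : ℝ) / N) * flipDissipation (profile N ρ) m i) +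
      ((1 + 2 * K + (a₀ + b₀ + a₁ + b₁) * (1 + K)) * N + 2 * K ^ 2 * σ) := by
  have hN' : (0 : ℝ) < N := by exact_mod_cast hN
  have h1 := sum_excGen_logDensity_le hp hp' hσ _ hm hm1 hκ
  have h2 := sum_glauberGen_logDensity_le hr hV hm
  have h3 := sum_flip_logDensity_le hr hm hm1 0 ha₀ hb₀ (hK 0)
  have h4 := sum_flip_logDensity_le hr hm hm1 (Fin.last N) ha₁ hb₁ (hK _)
  have h5 : ∑ η, m η * gen N p σ V ρ a₀ b₀ a₁ b₁ (logDensity (profile N ρ) m) η = N *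
      (∑ η, m η * excGen p σ (logDensity (profile N ρ) m) η +
       ∑ η, m η * glauberGen V ρ (logDensity (profile N ρ) m) η +
       (∑ η, m η * ((a₀ * (1 - occ η 0) + b₀ * occ η 0) *
          (logDensity (profile N ρ) m (flipSite η 0) - logDensity (profile N ρ) m η)) +
        ∑ η, m η * ((a₁ * (1 - occ η (Fin.last N)) + b₁ * occ η (Fin.last N)) *
          (logDensity (profile N ρ) m (flipSite η (Fin.last N)) -
            logDensity (profile N ρ) m η)))) := by
    simp only [← Finset.sum_add_distrib, Finset.mul_sum]
    refine Finset.sum_congr rfl fun η _ => ?_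
    simp only [gen, bdGen]
    ring
  rw [h5]
  refine (mul_le_mul_of_nonneg_left (add_le_add (add_le_add h1 h2) (add_le_add h3 h4))
    hN'.le).trans_eq ?_
  field_simp
  ring

/-! ### Fluctuations controlled by the dissipation -/

/-- The centred occupation variable. -/
def centredOcc (r : Fin (N + 1) → ℝ) (η : Config N) (i : Fin (N + 1)) : ℝ := occ η i - r i

lemma abs_centredOcc_le_one {r : Fin (N + 1) → ℝ} (hr : ∀ i, r i ∈ Ioo (0 : ℝ) 1)
    (η : Config N) (i : Fin (N + 1)) : |centredOcc r η i| ≤ 1 := by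
  have := hr i
  have := occ_nonneg η i
  have := occ_le_one η i
  simp only [mem_Ioo] at *
  rw [centredOcc, abs_le]
  constructor <;> linarith

/-- At equilibrium at `i` the variable `η_i - r_i` is centred given the other sites, hence
orthogonal to every `g` that ignores `η_i`. In general the pairing is controlled by the imbalance of
`flipMass` under the flip, which Young's inequality compares with the dissipation. -/
lemma sum_centredOcc_mul_le {r : Fin (N + 1) → ℝ} (hr : ∀ i, r i ∈ Ioo (0 : ℝ) 1)
    {m : Config N → ℝ} (hm : ∀ η, 0 < m η) (hm1 : ∑ η, m η = 1) (i : Fin (N + 1))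
    {g : Config N → ℝ} (hg : ∀ η, g (flipSite η i) = g η) {G : ℝ} (hG : ∀ η, |g η| ≤ G)
    {θ : ℝ} (hθ : 0 < θ) :
    ∑ η, m η * (centredOcc r η i * g η) ≤ G * (θ * flipDissipation r m i + 1 / (4 * θ)) := by
  have hT := flipSite_involutive (N := N) i
  set e : Config N → ℝ := fun η => if η i then 1 else -1 with he
  have heT : ∀ η, e (flipSite η i) = -e η := by
    intro η
    simp only [he, flipSite, Function.update_self]
    cases η i <;> simp
  have he1 : ∀ η, |e η| = 1 := by
    intro η
    simp only [he]
    split_ifs <;> simp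
  set a := flipMass r m i with ha
  have hap : ∀ η, 0 < a η := flipMass_pos hr hm i
  -- The centred occupation is `1 - r i` or `-r i`: up to the sign `e`, the weight of the opposite
  -- value.
  have h1 : ∀ η, m η * (centredOcc r η i * g η) = a η * (e η * g η) := by
    intro η
    simp only [ha, flipMass, siteProb, he, centredOcc, occ]
    cases η i <;> simp <;> ring
  -- Under the flip `e` is odd and `g` is even, so only the antisymmetric part of `a` survives.
  have h2 : ∑ η, a η * (e η * g η) = 1 / 2 * ∑ η, (a η - a (flipSite η i)) * (e η * g η) := by
    have h := sum_comp_involutive hT (fun η => a η * (e η * g η))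
    simp only [heT, hg] at h
    simp only [sub_mul, Finset.sum_sub_distrib]
    have h' : ∑ η, a (flipSite η i) * (e η * g η) = -∑ η, a (flipSite η i) * (-e η * g η) := by
      rw [← Finset.sum_neg_distrib]
      exact Finset.sum_congr rfl fun η _ => by ring
    rw [h', h]
    ring
  have h3 : ∀ η, (a η - a (flipSite η i)) * (e η * g η) ≤
      G * (θ * ((a η - a (flipSite η i)) ^ 2 / (a η + a (flipSite η i))) +
        (a η + a (flipSite η i)) / (4 * θ)) := by
    intro η
    have h4 := abs_sub_le_dissipation (hap η) (hap (flipSite η i)) hθ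
    have hG0 : 0 ≤ G := (abs_nonneg _).trans (hG η)
    calc _ ≤ |(a η - a (flipSite η i)) * (e η * g η)| := le_abs_self _
      _ = |g η| * |a η - a (flipSite η i)| := by rw [abs_mul, abs_mul, he1]; ring
      _ ≤ _ := mul_le_mul (hG η) h4 (abs_nonneg _) hG0
  have hG0 : 0 ≤ G := (abs_nonneg _).trans (hG fun _ => true)
  have h5 : ∑ η, a η ≤ 1 := by
    rw [← hm1]
    exact Finset.sum_le_sum fun η _ =>
      mul_le_of_le_one_right (hm η).le (siteProb_le_one (hr i) _)
  calc ∑ η, m η * (centredOcc r η i * g η)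
      = 1 / 2 * ∑ η, (a η - a (flipSite η i)) * (e η * g η) := by
        rw [← h2]; exact Finset.sum_congr rfl fun η _ => h1 η
    _ ≤ 1 / 2 * ∑ η, G * (θ * ((a η - a (flipSite η i)) ^ 2 / (a η + a (flipSite η i))) +
        (a η + a (flipSite η i)) / (4 * θ)) := by
        exact mul_le_mul_of_nonneg_left (Finset.sum_le_sum fun η _ => h3 η) (by norm_num)
    _ = G * (θ * flipDissipation r m i + (∑ η, a η) / (4 * θ)) := by
        rw [← Finset.mul_sum, Finset.sum_add_distrib, ← Finset.mul_sum, ← Finset.sum_div,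
          Finset.sum_add_distrib, sum_comp_involutive hT a, flipDissipation]
        ring
    _ ≤ _ := by gcongr

/-- The second moment of the fluctuation of the number of particles in `A` is controlled by the
dissipation at the sites of `A`. -/
lemma sum_sq_fluctuation_le {r : Fin (N + 1) → ℝ} (hr : ∀ i, r i ∈ Ioo (0 : ℝ) 1)
    {m : Config N → ℝ} (hm : ∀ η, 0 < m η) (hm1 : ∑ η, m η = 1) (A : Finset (Fin (N + 1)))
    {θ : ℝ} (hθ : 0 < θ) :
    ∑ η, m η * (∑ i ∈ A, centredOcc r η i) ^ 2 ≤
      A.card + A.card * (θ * ∑ i ∈ A, flipDissipation r m i + A.card / (4 * θ)) := by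
  -- For each `i` the diagonal term is separated, so that the remaining factor does not depend on
  -- `η_i`.
  have h1 : ∑ η, m η * (∑ i ∈ A, centredOcc r η i) ^ 2 =
      ∑ i ∈ A, (∑ η, m η * (centredOcc r η i * ∑ j ∈ A.erase i, centredOcc r η j) +
        ∑ η, m η * centredOcc r η i ^ 2) := by
    simp only [← Finset.sum_add_distrib]
    rw [Finset.sum_comm]
    refine Finset.sum_congr rfl fun η _ => ?_
    rw [sq, Finset.sum_mul, Finset.mul_sum]
    refine Finset.sum_congr rfl fun i hi => ?_
    rw [← Finset.add_sum_erase A _ hi]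
    ring
  have h2 : ∀ i ∈ A, ∑ η, m η * (centredOcc r η i * ∑ j ∈ A.erase i, centredOcc r η j) ≤
      A.card * (θ * flipDissipation r m i + 1 / (4 * θ)) := by
    intro i hi
    refine sum_centredOcc_mul_le hr hm hm1 i (fun η => ?_) (fun η => ?_) hθ
    · refine Finset.sum_congr rfl fun j hj => ?_
      have : j ≠ i := Finset.ne_of_mem_erase hj
      simp [centredOcc, occ, flipSite, this]
    · refine (Finset.abs_sum_le_sum_abs _ _).trans ?_
      refine (Finset.sum_le_card_nsmul _ _ 1 fun j _ => abs_centredOcc_le_one hr η j).trans ?_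
      rw [nsmul_eq_mul, mul_one]
      exact_mod_cast Finset.card_le_card (Finset.erase_subset _ _)
  have h3 : ∀ i ∈ A, ∑ η, m η * centredOcc r η i ^ 2 ≤ 1 := by
    intro i hi
    rw [← hm1]
    refine Finset.sum_le_sum fun η _ => mul_le_of_le_one_right (hm η).le ?_
    rw [← sq_abs]
    exact pow_le_one₀ (abs_nonneg _) (abs_centredOcc_le_one hr η i)
  rw [h1]
  refine (Finset.sum_le_sum fun i hi => add_le_add (h2 i hi) (h3 i hi)).trans_eq ?_
  rw [Finset.sum_add_distrib, ← Finset.mul_sum, Finset.sum_add_distrib, ← Finset.mul_sum]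
  simp only [Finset.sum_const, nsmul_eq_mul]
  ring

end

end OpenASEP

namespace OpenASEP

noncomputable section

/-- Gibbs' inequality against the uniform law. -/
lemma neg_log_card_le_sum_mul_log {S : Type*} [Fintype S] {m : S → ℝ} (hm : ∀ η, 0 < m η) (hm1 : ∑ η, m η = 1) :
    -Real.log (Fintype.card S) ≤ ∑ η, m η * Real.log (m η) := by
  have hS : 0 < Fintype.card S := by
    rw [Fintype.card_pos_iff]
    by_contra h
    rw [not_nonempty_iff] at h
    simp at hm1
  have hS' : (0 : ℝ) < Fintype.card S := by exact_mod_cast hS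
  have h1 : ∀ η, m η * (-Real.log (Fintype.card S)) + m η - (Fintype.card S : ℝ)⁻¹ ≤
      m η * Real.log (m η) := by
    intro η
    have := mul_log_sub_log_le (hm η) (inv_pos.2 hS')
    rw [Real.log_inv] at this
    linarith
  have h2 := Finset.sum_le_sum fun η (_ : η ∈ Finset.univ) => h1 η
  rw [Finset.sum_sub_distrib, Finset.sum_add_distrib, ← Finset.sum_mul, hm1, Finset.sum_const,
    Finset.card_univ, nsmul_eq_mul, mul_inv_cancel₀ hS'.ne'] at h2
  linarith

/-! ### Exponentials of rate matrices -/

section Exponential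

variable {S : Type*} [Fintype S] [DecidableEq S]

open scoped Matrix.Norms.Operator in
lemma hasSum_matrix_exp_apply (A : Matrix S S ℝ) (i j : S) :
    HasSum (fun n : ℕ => ((n.factorial : ℝ)⁻¹) * (A ^ n) i j) (NormedSpace.exp A i j) := by
  have h := NormedSpace.exp_series_hasSum_exp' (𝕂 := ℝ) A
  have h2 := h.map (Matrix.entryLinearMap ℝ ℝ i j)
    (LinearMap.continuous_of_finiteDimensional _)
  simp only [Function.comp_def, map_smul, smul_eq_mul] at h2
  exact h2

lemma one_apply_le_exp_of_nonneg {A : Matrix S S ℝ} (hA : ∀ i j, 0 ≤ A i j) (i j : S) :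
    (1 : Matrix S S ℝ) i j ≤ NormedSpace.exp A i j := by
  have hpow : ∀ n : ℕ, ∀ i j, 0 ≤ (A ^ n) i j := by
    intro n
    induction n with
    | zero =>
      intro i j
      rw [pow_zero, Matrix.one_apply]
      split_ifs <;> norm_num
    | succ n ih =>
      intro i j
      rw [pow_succ, Matrix.mul_apply]
      exact Finset.sum_nonneg fun k _ => mul_nonneg (ih i k) (hA k j)
  have := le_hasSum (hasSum_matrix_exp_apply A i j) 0
    fun n _ => mul_nonneg (by positivity) (hpow n i j)
  simpa using this

/-- Adding a large multiple `c` of the identity makes `t • Q` entrywise nonnegative, so its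
exponential dominates the identity; the commuting shift costs the factor `exp (-c)`. It follows that
the evolution preserves nonnegativity and strict positivity, the latter being needed to take
logarithms. -/
lemma exists_pos_mul_one_apply_le_exp {Q : Matrix S S ℝ} (hQ : ∀ i j, i ≠ j → 0 ≤ Q i j) {t : ℝ}
    (ht : 0 ≤ t) : ∃ c : ℝ, 0 < c ∧
      ∀ i j, c * (1 : Matrix S S ℝ) i j ≤ NormedSpace.exp (t • Q) i j := by
  set c : ℝ := ∑ i, t * |Q i i| with hc
  set D : Matrix S S ℝ := Matrix.diagonal fun _ => -c with hD
  have hsplit : t • Q = (t • Q - D) + D := by abel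
  have hcomm : Commute (t • Q - D) D := by
    have : D = (-c) • (1 : Matrix S S ℝ) := by
      rw [hD, Matrix.smul_one_eq_diagonal]
    rw [this]
    exact (Commute.one_right _).smul_right _
  have hDexp : NormedSpace.exp D = Matrix.diagonal fun _ => Real.exp (-c) := by
    rw [hD, Matrix.exp_diagonal]
    congr 1
    ext i
    rw [Pi.coe_exp, Real.exp_eq_exp_ℝ]
  have hnn : ∀ i j, 0 ≤ (t • Q - D) i j := by
    intro i j
    by_cases hij : i = j
    · subst hij
      have h1 : t * |Q i i| ≤ c :=
        Finset.single_le_sum (f := fun i => t * |Q i i|) (fun i _ => by positivity)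
          (Finset.mem_univ i)
      have h2 : -(t * |Q i i|) ≤ t * Q i i := by
        rw [← mul_neg]
        exact mul_le_mul_of_nonneg_left (neg_abs_le _) ht
      simp only [hD, Matrix.sub_apply, Matrix.smul_apply, smul_eq_mul, Matrix.diagonal_apply_eq]
      linarith
    · simp only [hD, Matrix.sub_apply, Matrix.smul_apply, smul_eq_mul,
        Matrix.diagonal_apply_ne _ hij, sub_zero]
      exact mul_nonneg ht (hQ i j hij)
  refine ⟨Real.exp (-c), Real.exp_pos _, fun i j => ?_⟩
  rw [hsplit, Matrix.exp_add_of_commute _ _ hcomm, hDexp, Matrix.mul_diagonal, mul_comm]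
  exact mul_le_mul_of_nonneg_right (one_apply_le_exp_of_nonneg hnn i j) (Real.exp_pos _).le

/-- The law at time `t` of the chain with rate matrix `Q` and initial law `m₀`. -/
def evolve (Q : Matrix S S ℝ) (m₀ : S → ℝ) (t : ℝ) (ξ : S) : ℝ :=
  ∑ η, m₀ η * NormedSpace.exp (t • Q) η ξ

lemma evolve_zero (Q : Matrix S S ℝ) (m₀ : S → ℝ) : evolve Q m₀ 0 = m₀ := by
  ext ξ
  simp [evolve, Matrix.one_apply]

lemma evolve_nonneg {Q : Matrix S S ℝ} (hQ : ∀ i j, i ≠ j → 0 ≤ Q i j) {m₀ : S → ℝ}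
    (hm : ∀ η, 0 ≤ m₀ η) {t : ℝ} (ht : 0 ≤ t) (ξ : S) : 0 ≤ evolve Q m₀ t ξ := by
  obtain ⟨c, hc, h⟩ := exists_pos_mul_one_apply_le_exp hQ ht
  refine Finset.sum_nonneg fun η _ => mul_nonneg (hm η) (le_trans ?_ (h η ξ))
  refine mul_nonneg hc.le ?_
  rw [Matrix.one_apply]
  split_ifs <;> norm_num

lemma evolve_pos {Q : Matrix S S ℝ} (hQ : ∀ i j, i ≠ j → 0 ≤ Q i j) {m₀ : S → ℝ}
    (hm : ∀ η, 0 < m₀ η) {t : ℝ} (ht : 0 ≤ t) (ξ : S) : 0 < evolve Q m₀ t ξ := by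
  obtain ⟨c, hc, h⟩ := exists_pos_mul_one_apply_le_exp hQ ht
  have hnn : ∀ η, 0 ≤ NormedSpace.exp (t • Q) η ξ := by
    refine fun η => le_trans (mul_nonneg hc.le ?_) (h η ξ)
    rw [Matrix.one_apply]
    split_ifs <;> norm_num
  refine Finset.sum_pos' (fun η _ => mul_nonneg (hm η).le (hnn η)) ⟨ξ, Finset.mem_univ _, ?_⟩
  refine mul_pos (hm ξ) (lt_of_lt_of_le hc ?_)
  simpa using h ξ ξ

open scoped Matrix.Norms.Operator in
lemma hasDerivAt_evolve (Q : Matrix S S ℝ) (m₀ : S → ℝ) (t : ℝ) (ξ : S) :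
    HasDerivAt (fun t => evolve Q m₀ t ξ) (∑ η, evolve Q m₀ t η * Q η ξ) t := by
  have h := hasDerivAt_exp_smul_const (𝕂 := ℝ) Q t
  set Λ : Matrix S S ℝ →ₗ[ℝ] ℝ := ∑ η, m₀ η • Matrix.entryLinearMap ℝ ℝ η ξ with hΛ
  have hΛ' : ∀ A, Λ A = ∑ η, m₀ η * A η ξ := by
    intro A
    simp [hΛ, LinearMap.sum_apply]
  have h2 := (LinearMap.toContinuousLinearMap Λ).hasFDerivAt.comp_hasDerivAt t h
  have h3 : (fun t => evolve Q m₀ t ξ) =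
      LinearMap.toContinuousLinearMap Λ ∘ fun u : ℝ => NormedSpace.exp (u • Q) := by
    ext u
    simp [hΛ', evolve]
  rw [h3]
  refine h2.congr_deriv ((hΛ' _).trans ?_)
  simp only [evolve, Matrix.mul_apply, Finset.sum_mul, Finset.mul_sum]
  rw [Finset.sum_comm]
  exact Finset.sum_congr rfl fun _ _ => Finset.sum_congr rfl fun _ _ => (mul_assoc _ _ _).symm

lemma continuous_evolve (Q : Matrix S S ℝ) (m₀ : S → ℝ) (ξ : S) :
    Continuous fun t => evolve Q m₀ t ξ :=
  continuous_iff_continuousAt.2 fun t => (hasDerivAt_evolve Q m₀ t ξ).continuousAt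

lemma sum_evolve {Q : Matrix S S ℝ} (hQ : ∀ i, ∑ j, Q i j = 0) (m₀ : S → ℝ) (t : ℝ) :
    ∑ ξ, evolve Q m₀ t ξ = ∑ ξ, m₀ ξ := by
  have hd : ∀ s, HasDerivAt (fun s => ∑ ξ, evolve Q m₀ s ξ) 0 s := by
    intro s
    have h := HasDerivAt.fun_sum fun ξ (_ : ξ ∈ Finset.univ) => hasDerivAt_evolve Q m₀ s ξ
    refine h.congr_deriv ?_
    rw [Finset.sum_comm]
    simp [← Finset.mul_sum, hQ]
  have := is_const_of_deriv_eq_zero (fun s => (hd s).differentiableAt) (fun s => (hd s).deriv) t 0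
  rw [this, evolve_zero]

lemma evolve_add_smul (Q : Matrix S S ℝ) (m₀ m₁ : S → ℝ) (a b t : ℝ) (ξ : S) :
    evolve Q (fun η => a * m₀ η + b * m₁ η) t ξ =
      a * evolve Q m₀ t ξ + b * evolve Q m₁ t ξ := by
  simp only [evolve, Finset.mul_sum, ← Finset.sum_add_distrib]
  exact Finset.sum_congr rfl fun _ _ => by ring

lemma hasDerivAt_relative_entropy {Q : Matrix S S ℝ} (hQ : ∀ i j, i ≠ j → 0 ≤ Q i j)
    (hQ0 : ∀ i, ∑ j, Q i j = 0) {m₀ : S → ℝ} (hm : ∀ η, 0 < m₀ η) (g : S → ℝ) {t : ℝ}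
    (ht : 0 ≤ t) :
    HasDerivAt (fun t => ∑ ξ, evolve Q m₀ t ξ * (Real.log (evolve Q m₀ t ξ) - g ξ))
      (∑ η, evolve Q m₀ t η * ∑ ξ, Q η ξ * (Real.log (evolve Q m₀ t ξ) - g ξ)) t := by
  have h1 : ∀ ξ, HasDerivAt (fun t => evolve Q m₀ t ξ * (Real.log (evolve Q m₀ t ξ) - g ξ))
      ((∑ η, evolve Q m₀ t η * Q η ξ) * (Real.log (evolve Q m₀ t ξ) - g ξ) +
        ∑ η, evolve Q m₀ t η * Q η ξ) t := by
    intro ξ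
    have hp := (evolve_pos hQ hm ht ξ).ne'
    have hd := hasDerivAt_evolve Q m₀ t ξ
    refine (hd.mul ((hd.log hp).sub_const (g ξ))).congr_deriv ?_
    field_simp
  have h2 := HasDerivAt.fun_sum fun ξ (_ : ξ ∈ Finset.univ) => h1 ξ
  refine h2.congr_deriv ?_
  -- The derivative of the logarithm contributes the rate of change of the total mass, which is
  -- zero.
  have h3 : ∑ ξ, ∑ η, evolve Q m₀ t η * Q η ξ = 0 := by
    rw [Finset.sum_comm]
    simp [← Finset.mul_sum, hQ0]
  rw [Finset.sum_add_distrib, h3, add_zero]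
  simp only [Finset.mul_sum, Finset.sum_mul]
  rw [Finset.sum_comm]
  exact Finset.sum_congr rfl fun _ _ => Finset.sum_congr rfl fun _ _ => by ring

end Exponential

/-! ### The generator as a rate matrix -/

variable {N : ℕ}

/-- The generator as a linear map. -/
def genLinear (N : ℕ) (p σ : ℝ) (V ρ : ℝ → ℝ) (a₀ b₀ a₁ b₁ : ℝ) :
    (Config N → ℝ) →ₗ[ℝ] (Config N → ℝ) where
  toFun f := gen N p σ V ρ a₀ b₀ a₁ b₁ f
  map_add' f g := by
    ext η
    have h1 : excGen p σ (f + g) η = excGen p σ f η + excGen p σ g η := by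
      simp only [excGen, ← Finset.sum_add_distrib, Pi.add_apply]
      exact Finset.sum_congr rfl fun _ _ => by ring
    have h2 : glauberGen V ρ (f + g) η = glauberGen V ρ f η + glauberGen V ρ g η := by
      simp only [glauberGen, ← mul_add, ← Finset.sum_add_distrib, Pi.add_apply]
      congr 1
      exact Finset.sum_congr rfl fun _ _ => by ring
    simp only [gen, h1, h2, bdGen, Pi.add_apply]
    ring
  map_smul' c f := by
    ext η
    have h1 : excGen p σ (c • f) η = c * excGen p σ f η := by
      simp only [excGen, Finset.mul_sum, Pi.smul_apply, smul_eq_mul]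
      exact Finset.sum_congr rfl fun _ _ => by ring
    have h2 : glauberGen V ρ (c • f) η = c * glauberGen V ρ f η := by
      simp only [glauberGen, Finset.mul_sum, Pi.smul_apply, smul_eq_mul]
      exact Finset.sum_congr rfl fun _ _ => by ring
    simp only [gen, h1, h2, bdGen, Pi.smul_apply, smul_eq_mul, RingHom.id_apply]
    ring

lemma sum_toRateMatrix_mul (p σ : ℝ) (V ρ : ℝ → ℝ) (a₀ b₀ a₁ b₁ : ℝ)
    (f : Config N → ℝ) (η : Config N) :
    ∑ ξ, toRateMatrix (gen N p σ V ρ a₀ b₀ a₁ b₁) η ξ * f ξ = gen N p σ V ρ a₀ b₀ a₁ b₁ f η := by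
  have h := LinearMap.pi_apply_eq_sum_univ (genLinear N p σ V ρ a₀ b₀ a₁ b₁) f
  have h2 := congrFun h η
  simp only [Finset.sum_apply, Pi.smul_apply, smul_eq_mul] at h2
  refine Eq.trans ?_ h2.symm
  refine Finset.sum_congr rfl fun ξ _ => ?_
  rw [mul_comm]
  have : (fun j => if ξ = j then (1 : ℝ) else 0) = Pi.single ξ 1 := by
    ext j
    simp [Pi.single_apply, eq_comm]
  rw [this]
  rfl

lemma sum_toRateMatrix (p σ : ℝ) (V ρ : ℝ → ℝ) (a₀ b₀ a₁ b₁ : ℝ) (η : Config N) :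
    ∑ ξ, toRateMatrix (gen N p σ V ρ a₀ b₀ a₁ b₁) η ξ = 0 := by
  have := sum_toRateMatrix_mul p σ V ρ a₀ b₀ a₁ b₁ (fun _ => 1) η
  simp only [mul_one] at this
  rw [this]
  simp [gen, excGen, glauberGen, bdGen]

lemma toRateMatrix_nonneg {p σ : ℝ} (hp : 0 ≤ p) (hp' : p ≤ 1) (hσ : 0 ≤ σ)
    {a₀ b₀ a₁ b₁ : ℝ} (ha₀ : 0 ≤ a₀) (hb₀ : 0 ≤ b₀) (ha₁ : 0 ≤ a₁) (hb₁ : 0 ≤ b₁)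
    {V ρ : ℝ → ℝ} (hr : ∀ i, profile N ρ i ∈ Ioo (0 : ℝ) 1)
    (hV : ∀ i ∈ interior N, 0 ≤ V (((i : ℕ) : ℝ) / N)) {η ξ : Config N} (hne : η ≠ ξ) :
    0 ≤ toRateMatrix (gen N p σ V ρ a₀ b₀ a₁ b₁) η ξ := by
  have hs : ∀ ζ : Config N, 0 ≤ (Pi.single ξ 1 : Config N → ℝ) ζ := by
    intro ζ
    rw [Pi.single_apply]
    split_ifs <;> norm_num
  have h0 : (Pi.single ξ 1 : Config N → ℝ) η = 0 := by simp [hne]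
  have ho := occ_nonneg η
  have ho' := fun i => sub_nonneg.2 (occ_le_one η i)
  unfold toRateMatrix gen excGen glauberGen bdGen
  simp only [h0, sub_zero]
  have h1 : 0 ≤ ∑ i : Fin N, (excRate p η i.castSucc i.succ + σ / 2) *
      (Pi.single ξ 1 : Config N → ℝ) (swapSites η i.castSucc i.succ) :=
    Finset.sum_nonneg fun i _ =>
      mul_nonneg (add_nonneg (excRate_nonneg hp hp' _ _ _) (by positivity)) (hs _)
  have h2 : 0 ≤ ∑ i ∈ Finset.univ.filter (fun i : Fin (N + 1) => 0 < (i : ℕ) ∧ (i : ℕ) < N),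
      glauberRate V ρ η i * (Pi.single ξ 1 : Config N → ℝ) (flipSite η i) := by
    refine Finset.sum_nonneg fun i hi => mul_nonneg ?_ (hs _)
    rw [glauberRate_eq]
    exact mul_nonneg (hV i hi) (siteProb_pos (hr i) _).le
  have h3 : 0 ≤ (a₀ * (1 - occ η 0) + b₀ * occ η 0) *
      (Pi.single ξ 1 : Config N → ℝ) (flipSite η 0) :=
    mul_nonneg (add_nonneg (mul_nonneg ha₀ (ho' _)) (mul_nonneg hb₀ (ho _))) (hs _)
  have h4 : 0 ≤ (a₁ * (1 - occ η (Fin.last N)) + b₁ * occ η (Fin.last N)) *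
      (Pi.single ξ 1 : Config N → ℝ) (flipSite η (Fin.last N)) :=
    mul_nonneg (add_nonneg (mul_nonneg ha₁ (ho' _)) (mul_nonneg hb₁ (ho _))) (hs _)
  positivity

end

end OpenASEP

namespace OpenASEP

noncomputable section

/-! ### The time-integrated fluctuations of a chain -/

variable {N : ℕ}

/-- The standing assumptions on the parameters of the dynamics with `N + 1` sites; `K` bounds the
logarithms of the weights of the reference measure and `N` times their increments. -/
structure Admissible (N : ℕ) (p σ : ℝ) (V ρ : ℝ → ℝ) (a₀ b₀ a₁ b₁ K : ℝ) : Prop where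
  size_pos : 0 < N
  half_le : 1 / 2 ≤ p
  le_one : p ≤ 1
  sigma_nonneg : 0 ≤ σ
  a₀_nonneg : 0 ≤ a₀
  b₀_nonneg : 0 ≤ b₀
  a₁_nonneg : 0 ≤ a₁
  b₁_nonneg : 0 ≤ b₁
  profile_mem : ∀ i, profile N ρ i ∈ Ioo (0 : ℝ) 1
  V_nonneg : ∀ i ∈ interior N, 0 ≤ V (((i : ℕ) : ℝ) / N)
  log_ge : ∀ i b, -K ≤ Real.log (siteProb (profile N ρ i) b)
  log_sub_le : ∀ (i : Fin N) b, |Real.log (siteProb (profile N ρ i.castSucc) b) -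
      Real.log (siteProb (profile N ρ i.succ) b)| ≤ K / N

/-- The constant in the entropy production. -/
def productionConst (N : ℕ) (σ a₀ b₀ a₁ b₁ K : ℝ) : ℝ :=
  (1 + 2 * K + (a₀ + b₀ + a₁ + b₁) * (1 + K)) * N + 2 * K ^ 2 * σ

lemma logRef_nonpos {r : Fin (N + 1) → ℝ} (hr : ∀ i, r i ∈ Ioo (0 : ℝ) 1) (η : Config N) :
    logRef r η ≤ 0 :=
  Finset.sum_nonpos fun i _ =>
    Real.log_nonpos (siteProb_pos (hr i) _).le (siteProb_le_one (hr i) _)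

lemma le_logRef {r : Fin (N + 1) → ℝ} {K : ℝ}
    (hK : ∀ i b, -K ≤ Real.log (siteProb (r i) b)) (η : Config N) :
    -((N + 1) * K) ≤ logRef r η := by
  have := Finset.card_nsmul_le_sum Finset.univ (fun i => Real.log (siteProb (r i) (η i))) (-K)
    fun i _ => hK i _
  simp only [Finset.card_univ, Fintype.card_fin, nsmul_eq_mul] at this
  push_cast at this
  unfold logRef
  linarith

variable {p σ : ℝ} {V ρ : ℝ → ℝ} {a₀ b₀ a₁ b₁ K : ℝ}

/-- The second moment `E` and the entropy `H` satisfy `E + κ H' ≤ B + κ C`: the dissipation bounding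
`E` is paid for by the decay of `H`. Integration over `[0, t]` leaves only the two end values of
`H`, both of order `N`. -/
lemma integral_fluctuation_le_of_pos (h : Admissible N p σ V ρ a₀ b₀ a₁ b₁ K)
    {m₀ : Config N → ℝ} (hm : ∀ η, 0 < m₀ η) (hm1 : ∑ η, m₀ η = 1)
    {A : Finset (Fin (N + 1))} (hA : A ⊆ interior N) {M : ℝ} (hM : 0 < M)
    (hAM : ∀ i ∈ A, M ≤ V (((i : ℕ) : ℝ) / N)) {θ : ℝ} (hθ : 0 < θ) {t : ℝ} (ht : 0 ≤ t) :
    ∫ s in (0 : ℝ)..t, ∑ η, evolve (toRateMatrix (gen N p σ V ρ a₀ b₀ a₁ b₁)) m₀ s η *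
        (∑ i ∈ A, centredOcc (profile N ρ) η i) ^ 2 ≤
      t * (A.card + A.card ^ 2 / (4 * θ)) + A.card * θ / M *
        (productionConst N σ a₀ b₀ a₁ b₁ K * t + (N + 1) * (K + Real.log 2)) := by
  set r := profile N ρ with hr
  set Q := toRateMatrix (gen N p σ V ρ a₀ b₀ a₁ b₁) with hQdef
  set C := productionConst N σ a₀ b₀ a₁ b₁ K with hC
  set E : ℝ → ℝ := fun s => ∑ η, evolve Q m₀ s η * (∑ i ∈ A, centredOcc r η i) ^ 2 with hE
  set H : ℝ → ℝ := fun s => ∑ ξ, evolve Q m₀ s ξ * (Real.log (evolve Q m₀ s ξ) - logRef r ξ)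
    with hH
  set B : ℝ := A.card + A.card ^ 2 / (4 * θ) with hB
  -- Chosen so that `κ * M = A.card * θ`, the coefficient of the dissipation in the second-moment
  -- bound, and the dissipation cancels exactly.
  set κ : ℝ := A.card * θ / M with hκ
  have hκ0 : 0 ≤ κ := by positivity
  have hQ : ∀ i j, i ≠ j → 0 ≤ Q i j := fun i j hij =>
    toRateMatrix_nonneg (by linarith [h.half_le]) h.le_one h.sigma_nonneg h.a₀_nonneg h.b₀_nonneg
      h.a₁_nonneg h.b₁_nonneg h.profile_mem h.V_nonneg hij
  have hQ0 : ∀ i, ∑ j, Q i j = 0 := fun i => sum_toRateMatrix _ _ _ _ _ _ _ _ i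
  have hpos : ∀ s, 0 ≤ s → ∀ ξ, 0 < evolve Q m₀ s ξ := fun s hs ξ => evolve_pos hQ hm hs ξ
  have hone : ∀ s, ∑ ξ, evolve Q m₀ s ξ = 1 := fun s => (sum_evolve hQ0 m₀ s).trans hm1
  have hEc : Continuous E := continuous_finsetSum _ fun η _ =>
    (continuous_evolve Q m₀ η).mul continuous_const
  have hHd : ∀ s, 0 ≤ s → ∃ d, HasDerivAt H d s ∧ E s + κ * d ≤ B + κ * C := by
    intro s hs
    refine ⟨_, hasDerivAt_relative_entropy hQ hQ0 hm (logRef r) hs, ?_⟩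
    have h1 : ∀ η, ∑ ξ, Q η ξ * (Real.log (evolve Q m₀ s ξ) - logRef r ξ) =
        gen N p σ V ρ a₀ b₀ a₁ b₁ (logDensity r (evolve Q m₀ s)) η := fun η =>
      sum_toRateMatrix_mul p σ V ρ a₀ b₀ a₁ b₁ (logDensity r (evolve Q m₀ s)) η
    simp only [h1]
    have h2 := sum_gen_logDensity_le h.size_pos h.half_le h.le_one h.sigma_nonneg h.a₀_nonneg
      h.b₀_nonneg h.a₁_nonneg h.b₁_nonneg h.profile_mem h.V_nonneg h.log_ge h.log_sub_le
      (hpos s hs) (hone s)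
    have h3 := sum_sq_fluctuation_le h.profile_mem (hpos s hs) (hone s) A hθ
    have h4 : M * ∑ i ∈ A, flipDissipation r (evolve Q m₀ s) i ≤
        ∑ i ∈ interior N, V (((i : ℕ) : ℝ) / N) * flipDissipation r (evolve Q m₀ s) i := by
      have hD := fun i => flipDissipation_nonneg h.profile_mem (hpos s hs) i
      rw [Finset.mul_sum]
      refine (Finset.sum_le_sum fun i hi => mul_le_mul_of_nonneg_right (hAM i hi) (hD i)).trans ?_
      exact Finset.sum_le_sum_of_subset_of_nonneg hA
        fun i hi _ => mul_nonneg (h.V_nonneg i hi) (hD i)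
    have h5 := mul_le_mul_of_nonneg_left (h2.trans (add_le_add_left (neg_le_neg h4) _)) hκ0
    have h6 : κ * (M * ∑ i ∈ A, flipDissipation r (evolve Q m₀ s) i) =
        A.card * (θ * ∑ i ∈ A, flipDissipation r (evolve Q m₀ s) i) := by
      rw [hκ]
      field_simp
    have h7 : (A.card : ℝ) * (A.card / (4 * θ)) = A.card ^ 2 / (4 * θ) := by ring
    have h8 : E s ≤ A.card + A.card *
      (θ * ∑ i ∈ A, flipDissipation r (evolve Q m₀ s) i + A.card / (4 * θ)) := h3
    have h9 : C = (1 + 2 * K + (a₀ + b₀ + a₁ + b₁) * (1 + K)) * N + 2 * K ^ 2 * σ := rfl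
    rw [← h9] at h5
    simp only [mul_add, mul_neg] at h5 h8
    rw [h6] at h5
    rw [h7] at h8
    simp only [hB]
    linarith
  set Φ : ℝ → ℝ := fun s => (∫ u in (0 : ℝ)..s, E u) + κ * H s - (B + κ * C) * s with hΦ
  have hΦd : ∀ s, 0 ≤ s → ∃ d, HasDerivAt Φ d s ∧ d ≤ 0 := by
    intro s hs
    obtain ⟨d, hd, hle⟩ := hHd s hs
    have h1 := intervalIntegral.integral_hasDerivAt_right (hEc.intervalIntegrable 0 s)
      (hEc.stronglyMeasurableAtFilter _ _) hEc.continuousAt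
    refine ⟨_, (h1.add (hd.const_mul κ)).sub ((hasDerivAt_id s).const_mul (B + κ * C)), ?_⟩
    linarith
  have hanti : AntitoneOn Φ (Icc 0 t) := by
    refine antitoneOn_of_deriv_nonpos (convex_Icc 0 t) ?_ ?_ ?_
    · intro s hs
      obtain ⟨d, hd, _⟩ := hΦd s hs.1
      exact hd.continuousAt.continuousWithinAt
    · intro s hs
      obtain ⟨d, hd, _⟩ := hΦd s (interior_subset hs).1
      exact hd.differentiableAt.differentiableWithinAt
    · intro s hs
      obtain ⟨d, hd, hle⟩ := hΦd s (interior_subset hs).1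
      rwa [hd.deriv]
  have hfin : Φ t ≤ Φ 0 := hanti ⟨le_rfl, ht⟩ ⟨ht, le_rfl⟩ ht
  have hH0 : H 0 ≤ (N + 1) * K := by
    simp only [hH, evolve_zero]
    calc _ ≤ ∑ ξ, m₀ ξ * ((N + 1) * K) := by
          refine Finset.sum_le_sum fun ξ _ => mul_le_mul_of_nonneg_left ?_ (hm ξ).le
          have h1 : m₀ ξ ≤ 1 := by
            rw [← hm1]
            exact Finset.single_le_sum (fun η _ => (hm η).le) (Finset.mem_univ ξ)
          have h2 := Real.log_nonpos (hm ξ).le h1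
          have h3 := le_logRef h.log_ge ξ
          linarith
      _ = (N + 1) * K := by rw [← Finset.sum_mul, hm1, one_mul]
  -- A bound of order `N` is enough here: `logRef` is nonpositive, and `∑ m log m` is at least minus
  -- the logarithm of the number of configurations.
  have hHt : -((N + 1) * Real.log 2) ≤ H t := by
    have h1 := neg_log_card_le_sum_mul_log (hpos t ht) (hone t)
    have h2 : Real.log (Fintype.card (Config N)) = (N + 1) * Real.log 2 := by
      simp [Config, Real.log_pow]
    rw [h2] at h1
    refine h1.trans (Finset.sum_le_sum fun ξ _ => ?_)
    exact mul_le_mul_of_nonneg_left (by linarith [logRef_nonpos h.profile_mem ξ]) (hpos t ht ξ).le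
  simp only [hΦ, intervalIntegral.integral_same] at hfin
  have h1 := mul_le_mul_of_nonneg_left (sub_le_sub hH0 hHt) hκ0
  simp only [hE] at hfin ⊢
  nlinarith

/-- The time-integrated second moment of the fluctuation of the number of particles in `A`. -/
lemma integral_fluctuation_le (h : Admissible N p σ V ρ a₀ b₀ a₁ b₁ K)
    {m₀ : Config N → ℝ} (hm : ∀ η, 0 ≤ m₀ η) (hm1 : ∑ η, m₀ η = 1)
    {A : Finset (Fin (N + 1))} (hA : A ⊆ interior N) {M : ℝ} (hM : 0 < M)
    (hAM : ∀ i ∈ A, M ≤ V (((i : ℕ) : ℝ) / N)) {θ : ℝ} (hθ : 0 < θ) {t : ℝ} (ht : 0 ≤ t) :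
    ∫ s in (0 : ℝ)..t, ∑ η, evolve (toRateMatrix (gen N p σ V ρ a₀ b₀ a₁ b₁)) m₀ s η *
        (∑ i ∈ A, centredOcc (profile N ρ) η i) ^ 2 ≤
      2 * (t * (A.card + A.card ^ 2 / (4 * θ)) + A.card * θ / M *
        (productionConst N σ a₀ b₀ a₁ b₁ K * t + (N + 1) * (K + Real.log 2))) := by
  set Q := toRateMatrix (gen N p σ V ρ a₀ b₀ a₁ b₁) with hQdef
  have hQ : ∀ i j, i ≠ j → 0 ≤ Q i j := fun i j hij =>
    toRateMatrix_nonneg (by linarith [h.half_le]) h.le_one h.sigma_nonneg h.a₀_nonneg h.b₀_nonneg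
      h.a₁_nonneg h.b₁_nonneg h.profile_mem h.V_nonneg hij
  have hcard : (0 : ℝ) < Fintype.card (Config N) := by exact_mod_cast Fintype.card_pos
  -- An arbitrary initial law may vanish at some configurations. Its equal mixture with the uniform
  -- law is positive, and since the evolution is linear and the integrand nonnegative, this costs
  -- only a factor `2`.
  set u : Config N → ℝ := fun _ => (Fintype.card (Config N) : ℝ)⁻¹ with hu
  have hu1 : ∑ η, u η = 1 := by
    simp only [hu, Finset.sum_const, Finset.card_univ, nsmul_eq_mul]
    exact mul_inv_cancel₀ hcard.ne'
  have hu0 : ∀ η, 0 < u η := fun η => inv_pos.2 hcard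
  have h1 := integral_fluctuation_le_of_pos h
    (m₀ := fun η => 1 / 2 * m₀ η + 1 / 2 * u η)
    (fun η => by linarith [hm η, hu0 η])
    (by rw [Finset.sum_add_distrib, ← Finset.mul_sum, ← Finset.mul_sum, hm1, hu1]; norm_num)
    hA hM hAM hθ ht
  have hc : ∀ m : Config N → ℝ, Continuous fun s => ∑ η, evolve Q m s η *
      (∑ i ∈ A, centredOcc (profile N ρ) η i) ^ 2 := fun m =>
    continuous_finsetSum _ fun η _ => (continuous_evolve Q m η).mul continuous_const
  have h2 : ∫ s in (0 : ℝ)..t, 1 / 2 * ∑ η, evolve Q m₀ s η *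
      (∑ i ∈ A, centredOcc (profile N ρ) η i) ^ 2 ≤
      ∫ s in (0 : ℝ)..t, ∑ η, evolve Q (fun η => 1 / 2 * m₀ η + 1 / 2 * u η) s η *
      (∑ i ∈ A, centredOcc (profile N ρ) η i) ^ 2 := by
    refine intervalIntegral.integral_mono_on ht
      ((continuous_const.mul (hc m₀)).intervalIntegrable _ _)
      ((hc _).intervalIntegrable _ _) fun s hs => ?_
    rw [Finset.mul_sum]
    refine Finset.sum_le_sum fun η _ => ?_
    rw [evolve_add_smul, ← mul_assoc]
    refine mul_le_mul_of_nonneg_right ?_ (sq_nonneg _)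
    have := evolve_nonneg hQ (fun η => (hu0 η).le) hs.1 η
    linarith
  rw [intervalIntegral.integral_const_mul] at h2
  linarith

end

end OpenASEP

namespace OpenASEP

noncomputable section

/-! ### Occupation times of a Markov process -/

section MarkovProcess

variable {N : ℕ} {Ω : Type*} [MeasurableSpace Ω] {L : (Config N → ℝ) → Config N → ℝ}
  {μ : Measure (Config N)} {P : Measure Ω} {X : ℝ≥0 → Ω → Config N}

lemma IsMarkovProcess.measureReal_eq_evolve [IsProbabilityMeasure P]
    (h : IsMarkovProcess L μ P X) (s : ℝ≥0) (ξ : Config N) :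
    P.real {ω | X s ω = ξ} = evolve (toRateMatrix L) (fun η => μ.real {η}) s ξ := by
  have h1 : {ω | X s ω = ξ} =
      ⋃ η ∈ (Finset.univ : Finset (Config N)), {ω | X 0 ω = η ∧ X s ω = ξ} := by
    ext ω
    simp
  have hms : ∀ u ζ, MeasurableSet {ω | X u ω = ζ} := fun u ζ =>
    h.measurable u (measurableSet_singleton ζ)
  rw [h1, measureReal_biUnion_finset, evolve]
  · refine Finset.sum_congr rfl fun η _ => ?_
    -- The finite-dimensional laws start at time `0`, so the law at time `s` is a marginal of the
    -- joint law at the times `0` and `s`.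
    have h2 := h.fin_dim 1 (fun k => if k = 0 then 0 else s) (fun k => if k = 0 then η else ξ)
      (by
        intro a b hab
        dsimp only
        split_ifs with ha hb
        · exact le_rfl
        · exact zero_le
        · omega
        · exact le_rfl) (by simp)
    have h3 : {ω | ∀ k ≤ 1, X (if k = 0 then 0 else s) ω = if k = 0 then η else ξ} =
        {ω | X 0 ω = η ∧ X s ω = ξ} := by
      ext ω
      constructor
      · intro hω
        exact ⟨by simpa using hω 0 (by norm_num), by simpa using hω 1 le_rfl⟩
      · rintro ⟨h0, h1⟩ k hk
        interval_cases k
        · simpa using h0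
        · simpa using h1
    rw [h3] at h2
    rw [h2]
    simp
  · intro η _ ζ _ hne
    rw [Function.onFun, Set.disjoint_left]
    rintro ω ⟨h1, _⟩ ⟨h2, _⟩
    exact hne (h1.symm.trans h2)
  · intro η _
    exact (hms 0 η).inter (hms s ξ)

/-- The `+ 1` in the numerator puts the grid point on the right of `s`, where the paths are
continuous. -/
lemma tendsto_discretization_right (s : ℝ≥0) :
    Tendsto (fun n : ℕ => ((⌊((n : ℝ≥0) + 1) * s⌋₊ : ℝ≥0) + 1) / ((n : ℝ≥0) + 1)) atTop
      (𝓝[≥] s) := by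
  have h1 : ∀ n : ℕ, s ≤ ((⌊((n : ℝ≥0) + 1) * s⌋₊ : ℝ≥0) + 1) / ((n : ℝ≥0) + 1) := by
    intro n
    rw [le_div_iff₀ (by positivity), mul_comm]
    exact (Nat.lt_floor_add_one _).le
  have h2 : ∀ n : ℕ, ((⌊((n : ℝ≥0) + 1) * s⌋₊ : ℝ≥0) + 1) / ((n : ℝ≥0) + 1) ≤
      s + 1 / ((n : ℝ≥0) + 1) := by
    intro n
    have h3 : ((n : ℝ≥0) + 1) ≠ 0 := by positivity
    rw [div_le_iff₀ (by positivity), add_mul s, one_div, inv_mul_cancel₀ h3, mul_comm s]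
    gcongr
    exact Nat.floor_le (by positivity)
  refine tendsto_nhdsWithin_iff.2 ⟨?_, Eventually.of_forall h1⟩
  refine tendsto_of_tendsto_of_tendsto_of_le_of_le tendsto_const_nhds ?_ h1 h2
  have := (tendsto_one_div_add_atTop_nhds_zero_nat (𝕜 := ℝ≥0)).const_add s
  simpa using this

lemma exists_discretization_right : ∃ (τ : ℕ → ℕ → ℝ≥0) (k : ℕ → ℝ → ℕ), (∀ n, Measurable (k n)) ∧
    ∀ s : ℝ, Tendsto (fun n => τ n (k n s)) atTop (𝓝[≥] s.toNNReal) :=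
  ⟨fun n k => ((k : ℝ≥0) + 1) / ((n : ℝ≥0) + 1), fun n s => ⌊((n : ℝ≥0) + 1) * s.toNNReal⌋₊,
    fun _ => Nat.measurable_floor.comp (measurable_real_toNNReal.const_mul _),
    fun s => tendsto_discretization_right s.toNNReal⟩

/-- Right continuity makes the process a pointwise limit of processes that read the path only on a
countable time grid. Joint measurability is what allows Fubini's theorem below. -/
lemma IsMarkovProcess.measurable_uncurry (h : IsMarkovProcess L μ P X) (g : Config N → ℝ) :
    Measurable fun q : ℝ × Ω => g (X q.1.toNNReal q.2) := by
  obtain ⟨τ, k, hk, hτ⟩ := exists_discretization_right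
  refine measurable_of_tendsto_metrizable (f := fun (n : ℕ) (q : ℝ × Ω) =>
    g (X (τ n (k n q.1)) q.2)) ?_ ?_
  · intro n
    have h1 : Measurable fun r : ℕ × Ω => g (X (τ n r.1) r.2) := by
      refine measurable_from_prod_countable_right fun j => ?_
      exact (Measurable.of_discrete (f := g)).comp (h.measurable (τ n j))
    exact h1.comp (((hk n).comp measurable_fst).prodMk measurable_snd)
  · rw [tendsto_pi_nhds]
    rintro ⟨s, ω⟩
    have h1 := (h.right_continuous ω s.toNNReal).tendsto.comp (hτ s)
    exact ((continuous_of_discreteTopology (f := g)).tendsto _).comp h1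

lemma IsMarkovProcess.intervalIntegrable (h : IsMarkovProcess L μ P X) (g : Config N → ℝ)
    (ω : Ω) {t : ℝ} (ht : 0 ≤ t) :
    IntervalIntegrable (fun s : ℝ => g (X s.toNNReal ω)) volume 0 t := by
  rw [intervalIntegrable_iff_integrableOn_Ioc_of_le ht]
  have hpath : Measurable fun s : ℝ => g (X s.toNNReal ω) :=
    (h.measurable_uncurry g).comp (measurable_id.prodMk measurable_const)
  refine Integrable.of_bound hpath.aestronglyMeasurable (∑ ζ, |g ζ|) ?_
  exact Eventually.of_forall fun s => Finset.single_le_sum (f := fun ζ => |g ζ|)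
    (fun _ _ => abs_nonneg _) (Finset.mem_univ _)

lemma IsMarkovProcess.integral_eq_sum_evolve [IsProbabilityMeasure P]
    (h : IsMarkovProcess L μ P X) (g : Config N → ℝ) (s : ℝ≥0) :
    ∫ ω, g (X s ω) ∂P = ∑ ξ, evolve (toRateMatrix L) (fun η => μ.real {η}) s ξ * g ξ := by
  have hm := h.measurable s
  have : IsProbabilityMeasure (P.map (X s)) := Measure.isProbabilityMeasure_map hm.aemeasurable
  rw [← integral_map hm.aemeasurable
    (Measurable.of_discrete (f := g)).aestronglyMeasurable, integral_fintype Integrable.of_finite]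
  refine Finset.sum_congr rfl fun ξ _ => ?_
  rw [← h.measureReal_eq_evolve, map_measureReal_apply hm (measurableSet_singleton ξ), smul_eq_mul]
  rfl

/-- Chebyshev's inequality for the time integral. Only the one-time marginals enter, because the
square of the integral is controlled by `t` times the integral of the square. -/
lemma IsMarkovProcess.measure_lt_abs_integral_le [IsProbabilityMeasure P]
    (h : IsMarkovProcess L μ P X) (g : Config N → ℝ) {t δ : ℝ} (ht : 0 < t) (hδ : 0 < δ) :
    P {ω | δ < |∫ s in (0 : ℝ)..t, g (X s.toNNReal ω)|} ≤
      ENNReal.ofReal (t / δ ^ 2 * ∫ s in (0 : ℝ)..t,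
        ∑ ξ, evolve (toRateMatrix L) (fun η => μ.real {η}) s ξ * g ξ ^ 2) := by
  have hmeas2 := h.measurable_uncurry fun ξ => g ξ ^ 2
  have hbound : ∀ ξ, g ξ ^ 2 ≤ ∑ ζ, g ζ ^ 2 := fun ξ =>
    Finset.single_le_sum (f := fun ζ => g ζ ^ 2) (fun _ _ => sq_nonneg _) (Finset.mem_univ ξ)
  have hI1 := fun ω => h.intervalIntegrable (fun ξ => |g ξ|) ω ht.le
  have hI2 := fun ω => h.intervalIntegrable (fun ξ => g ξ ^ 2) ω ht.le
  set Z : Ω → ℝ := fun ω => ∫ s in (0 : ℝ)..t, g (X s.toNNReal ω) ^ 2 with hZ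
  have hprod : Integrable (fun q : ℝ × Ω => g (X q.1.toNNReal q.2) ^ 2)
      ((volume.restrict (Ioc 0 t)).prod P) := by
    refine Integrable.of_bound hmeas2.aestronglyMeasurable (∑ ζ, g ζ ^ 2) ?_
    exact Eventually.of_forall fun s => by simpa using hbound _
  have hZint : Integrable Z P := by
    have := hprod.integral_prod_right
    simpa only [hZ, intervalIntegral.integral_of_le ht.le] using this
  have hZ0 : ∀ ω, 0 ≤ Z ω := fun ω =>
    intervalIntegral.integral_nonneg ht.le fun s _ => sq_nonneg _
  have hZE : ∫ ω, Z ω ∂P = ∫ s in (0 : ℝ)..t,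
      ∑ ξ, evolve (toRateMatrix L) (fun η => μ.real {η}) s ξ * g ξ ^ 2 := by
    simp only [hZ, intervalIntegral.integral_of_le ht.le]
    rw [← integral_integral_swap hprod]
    refine setIntegral_congr_fun measurableSet_Ioc fun s hs => ?_
    have := h.integral_eq_sum_evolve (fun ξ => g ξ ^ 2) s.toNNReal
    rw [Real.coe_toNNReal s hs.1.le] at this
    exact this
  have hsub : {ω | δ < |∫ s in (0 : ℝ)..t, g (X s.toNNReal ω)|} ⊆ {ω | δ ^ 2 / t ≤ Z ω} := by
    intro ω hω
    -- Young's inequality in place of Cauchy–Schwarz. The constant part integrates to `δ / 2`, so on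
    -- the event the quadratic part exceeds `δ / 2`.
    have h1 : |∫ s in (0 : ℝ)..t, g (X s.toNNReal ω)| ≤
        ∫ s in (0 : ℝ)..t, (δ / (2 * t) + t / (2 * δ) * g (X s.toNNReal ω) ^ 2) := by
      refine (intervalIntegral.abs_integral_le_integral_abs ht.le).trans ?_
      refine intervalIntegral.integral_mono_on ht.le (hI1 ω)
        (intervalIntegrable_const.add ((hI2 ω).const_mul _)) fun s _ => ?_
      rw [← sq_abs]
      have h2 : δ / (2 * t) + t / (2 * δ) * |g (X s.toNNReal ω)| ^ 2 - |g (X s.toNNReal ω)| =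
          (t * |g (X s.toNNReal ω)| - δ) ^ 2 / (2 * t * δ) := by
        field_simp
        ring
      have h3 : 0 ≤ (t * |g (X s.toNNReal ω)| - δ) ^ 2 / (2 * t * δ) := by positivity
      linarith
    rw [intervalIntegral.integral_add intervalIntegrable_const ((hI2 ω).const_mul _),
      intervalIntegral.integral_const, intervalIntegral.integral_const_mul, sub_zero,
      smul_eq_mul] at h1
    have h4 : δ < t * (δ / (2 * t)) + t / (2 * δ) * Z ω := lt_of_lt_of_le hω h1
    have h5 : t * (δ / (2 * t)) = δ / 2 := by field_simp
    rw [h5] at h4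
    have h6 : δ / 2 < t / (2 * δ) * Z ω := by linarith
    rw [mem_ofPred_eq, div_le_iff₀ ht]
    rw [div_mul_eq_mul_div, lt_div_iff₀ (by positivity)] at h6
    nlinarith
  refine (measure_mono hsub).trans ?_
  have h1 := mul_meas_ge_le_integral_of_nonneg (Eventually.of_forall hZ0) hZint (δ ^ 2 / t)
  rw [hZE] at h1
  rw [← ofReal_measureReal]
  refine ENNReal.ofReal_le_ofReal ?_
  have h2 := mul_le_mul_of_nonneg_left h1 (by positivity : 0 ≤ t / δ ^ 2)
  refine le_trans (le_of_eq ?_) h2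
  have h3 : t / δ ^ 2 * (δ ^ 2 / t) = 1 := by field_simp
  rw [← mul_assoc, h3, one_mul]

end MarkovProcess

end

end OpenASEP

namespace OpenASEP

noncomputable section

/-! ### Densities near a boundary -/

section Density

variable {N : ℕ}

/-- The boundary site `e` feels no Glauber dynamics, so it is not in `A`; with the rounding of `n`
it costs only `O(1/n)`. The rest of the error is the variation `ε` of the profile over `A`. -/
lemma sq_density_sub_le {r : Fin (N + 1) → ℝ} {A : Finset (Fin (N + 1))} {e : Fin (N + 1)}
    (he : e ∉ A) {n c ε : ℝ} (hn : 0 < n) (hA : A.card ≤ n) (hA' : n - 1 ≤ A.card)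
    (hc : c ∈ Icc (0 : ℝ) 1) (hε : 0 ≤ ε) (hr : ∀ i ∈ A, |r i - c| ≤ ε) (η : Config N) :
    (1 / n * ∑ i ∈ insert e A, occ η i - c) ^ 2 ≤
      2 / n ^ 2 * (∑ i ∈ A, centredOcc r η i) ^ 2 + 2 * (ε + 2 / n) ^ 2 := by
  set x := 1 / n * ∑ i ∈ A, centredOcc r η i with hx
  set R := 1 / n * (occ η e + ∑ i ∈ A, (r i - c) + (A.card - n) * c) with hR
  have h1 : 1 / n * ∑ i ∈ insert e A, occ η i - c = x + R := by
    simp only [hx, hR, centredOcc, Finset.sum_insert he, Finset.sum_sub_distrib,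
      Finset.sum_const, nsmul_eq_mul]
    field_simp
    ring
  have h2 : |∑ i ∈ A, (r i - c)| ≤ n * ε := by
    refine (Finset.abs_sum_le_sum_abs _ _).trans ?_
    refine (Finset.sum_le_card_nsmul _ _ ε hr).trans ?_
    rw [nsmul_eq_mul]
    gcongr
  have h3 : |R| ≤ ε + 2 / n := by
    have h4 : |occ η e + ∑ i ∈ A, (r i - c) + (A.card - n) * c| ≤ n * ε + 2 := by
      have h5 := occ_nonneg η e
      have h6 := occ_le_one η e
      obtain ⟨h7, h8⟩ := abs_le.1 h2
      obtain ⟨h9, h10⟩ := hc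
      rw [abs_le]
      constructor <;> nlinarith
    rw [hR, abs_mul, abs_of_pos (by positivity : 0 < 1 / n)]
    calc 1 / n * _ ≤ 1 / n * (n * ε + 2) := by gcongr
      _ = ε + 2 / n := by field_simp
  have h4 : R ^ 2 ≤ (ε + 2 / n) ^ 2 := sq_le_sq' (by linarith [abs_le.1 h3]) (abs_le.1 h3).2
  have h5 : x ^ 2 = 1 / n ^ 2 * (∑ i ∈ A, centredOcc r η i) ^ 2 := by rw [hx]; ring
  have h6 : 2 / n ^ 2 * (∑ i ∈ A, centredOcc r η i) ^ 2 = 2 * x ^ 2 := by rw [h5]; ring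
  rw [h1, h6]
  nlinarith [sq_nonneg (x - R)]

variable {p σ : ℝ} {V ρ : ℝ → ℝ} {a₀ b₀ a₁ b₁ K : ℝ}

lemma Admissible.K_nonneg (h : Admissible N p σ V ρ a₀ b₀ a₁ b₁ K) : 0 ≤ K := by
  have h1 := h.log_ge 0 true
  have h2 := Real.log_nonpos (siteProb_pos (h.profile_mem 0) true).le
    (siteProb_le_one (h.profile_mem 0) true)
  linarith

lemma Admissible.productionConst_nonneg (h : Admissible N p σ V ρ a₀ b₀ a₁ b₁ K) :
    0 ≤ productionConst N σ a₀ b₀ a₁ b₁ K := by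
  have := h.K_nonneg
  have := h.a₀_nonneg
  have := h.b₀_nonneg
  have := h.a₁_nonneg
  have := h.b₁_nonneg
  have := h.sigma_nonneg
  unfold productionConst
  positivity

/-- The density of particles in `A` (up to one extra site `e`) is close to `c` on time average. -/
lemma measure_density_le (h : Admissible N p σ V ρ a₀ b₀ a₁ b₁ K)
    {Ω : Type*} [MeasurableSpace Ω] {μ : Measure (Config N)} [IsProbabilityMeasure μ]
    {P : Measure Ω} [IsProbabilityMeasure P] {X : ℝ≥0 → Ω → Config N}
    (hX : IsMarkovProcess (gen N p σ V ρ a₀ b₀ a₁ b₁) μ P X)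
    {A : Finset (Fin (N + 1))} (hAi : A ⊆ interior N) {e : Fin (N + 1)}
    (he : e ∉ A) {n c ε : ℝ} (hn : 0 < n) (hA : A.card ≤ n) (hA' : n - 1 ≤ A.card)
    (hc : c ∈ Icc (0 : ℝ) 1) (hε : 0 ≤ ε) (hr : ∀ i ∈ A, |profile N ρ i - c| ≤ ε)
    {M : ℝ} (hM : 0 < M) (hAM : ∀ i ∈ A, M ≤ V (((i : ℕ) : ℝ) / N)) {θ : ℝ} (hθ : 0 < θ)
    {t δ : ℝ} (ht : 0 < t) (hδ : 0 < δ) :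
    P {ω | δ < |(∫ s in (0 : ℝ)..t, 1 / n * ∑ i ∈ insert e A, occ (X s.toNNReal ω) i) - t * c|} ≤
      ENNReal.ofReal (t / δ ^ 2 * (4 * (t * (1 / n + 1 / (4 * θ)) + θ / (M * n) *
        (productionConst N σ a₀ b₀ a₁ b₁ K * t + (N + 1) * (K + Real.log 2))) +
        2 * t * (ε + 2 / n) ^ 2)) := by
  set g : Config N → ℝ := fun η => 1 / n * ∑ i ∈ insert e A, occ η i - c with hg
  have h1 : ∀ ω, (∫ s in (0 : ℝ)..t, 1 / n * ∑ i ∈ insert e A, occ (X s.toNNReal ω) i) - t * c =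
      ∫ s in (0 : ℝ)..t, g (X s.toNNReal ω) := by
    intro ω
    have hI := hX.intervalIntegrable (fun η => 1 / n * ∑ i ∈ insert e A, occ η i) ω ht.le
    simp only [hg]
    rw [intervalIntegral.integral_sub hI intervalIntegrable_const,
      intervalIntegral.integral_const, sub_zero, smul_eq_mul]
  simp only [h1]
  refine (hX.measure_lt_abs_integral_le g ht hδ).trans (ENNReal.ofReal_le_ofReal ?_)
  refine mul_le_mul_of_nonneg_left ?_ (by positivity)
  set Q := toRateMatrix (gen N p σ V ρ a₀ b₀ a₁ b₁) with hQdef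
  have hQ : ∀ i j, i ≠ j → 0 ≤ Q i j := fun i j hij =>
    toRateMatrix_nonneg (by linarith [h.half_le]) h.le_one h.sigma_nonneg h.a₀_nonneg h.b₀_nonneg
      h.a₁_nonneg h.b₁_nonneg h.profile_mem h.V_nonneg hij
  have hQ0 : ∀ i, ∑ j, Q i j = 0 := fun i => sum_toRateMatrix _ _ _ _ _ _ _ _ i
  set m₀ : Config N → ℝ := fun η => μ.real {η} with hm₀
  have hm : ∀ η, 0 ≤ m₀ η := fun η => measureReal_nonneg
  have hm1 : ∑ η, m₀ η = 1 := by
    simp [hm₀]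
  have h2 := integral_fluctuation_le h hm hm1 hAi hM hAM hθ ht.le
  have hcont : ∀ f : Config N → ℝ, Continuous fun s => ∑ ξ, evolve Q m₀ s ξ * f ξ := fun f =>
    continuous_finsetSum _ fun ξ _ => (continuous_evolve Q m₀ ξ).mul continuous_const
  have h3 : ∫ s in (0 : ℝ)..t, ∑ ξ, evolve Q m₀ s ξ * g ξ ^ 2 ≤
      ∫ s in (0 : ℝ)..t, (2 / n ^ 2 * ∑ ξ, evolve Q m₀ s ξ *
        (∑ i ∈ A, centredOcc (profile N ρ) ξ i) ^ 2 + 2 * (ε + 2 / n) ^ 2) := by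
    refine intervalIntegral.integral_mono_on ht.le ((hcont _).intervalIntegrable _ _)
      (((continuous_const.mul (hcont _)).add continuous_const).intervalIntegrable _ _)
      fun s hs => ?_
    have h4 : ∀ ξ, evolve Q m₀ s ξ * g ξ ^ 2 ≤ evolve Q m₀ s ξ * (2 / n ^ 2 *
        (∑ i ∈ A, centredOcc (profile N ρ) ξ i) ^ 2 + 2 * (ε + 2 / n) ^ 2) := fun ξ =>
      mul_le_mul_of_nonneg_left (sq_density_sub_le he hn hA hA' hc hε hr ξ)
        (evolve_nonneg hQ hm hs.1 ξ)
    refine (Finset.sum_le_sum fun ξ _ => h4 ξ).trans_eq ?_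
    simp only [mul_add (evolve _ _ _ _)]
    rw [Finset.sum_add_distrib, ← Finset.sum_mul, sum_evolve hQ0, hm1, one_mul, Finset.mul_sum]
    congr 1
    exact Finset.sum_congr rfl fun ξ _ => by ring
  rw [intervalIntegral.integral_add (((hcont _).intervalIntegrable _ _).const_mul _)
    intervalIntegrable_const, intervalIntegral.integral_const_mul,
    intervalIntegral.integral_const, sub_zero, smul_eq_mul] at h3
  have hC := h.productionConst_nonneg
  have hK := h.K_nonneg
  have hlog : 0 ≤ Real.log 2 := Real.log_nonneg (by norm_num)
  set W := productionConst N σ a₀ b₀ a₁ b₁ K * t + (N + 1) * (K + Real.log 2) with hW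
  have hW0 : 0 ≤ W := by positivity
  have h5 : 2 * (t * (A.card + A.card ^ 2 / (4 * θ)) + A.card * θ / M * W) ≤
      2 * (t * (n + n ^ 2 / (4 * θ)) + n * θ / M * W) := by gcongr
  have h6 := mul_le_mul_of_nonneg_left (h2.trans h5) (by positivity : 0 ≤ 2 / n ^ 2)
  have h7 : 2 / n ^ 2 * (2 * (t * (n + n ^ 2 / (4 * θ)) + n * θ / M * W)) =
      4 * (t * (1 / n + 1 / (4 * θ)) + θ / (M * n) * W) := by
    field_simp
    ring
  rw [h7] at h6
  linarith

end Density

/-! ### The limit -/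

/-- Both boundaries are treated at once: `A N y` is the set of bulk sites counted, `e N` the
boundary site, and `m y` a lower bound for `V` on `A N y`. -/
lemma tendsto_limsup_measure_density
    {p : ℝ} {σ : ℕ → ℝ} (hσ_N : Tendsto (fun N : ℕ => σ N / N) atTop (𝓝 0))
    {V ρ : ℝ → ℝ} {a₀ b₀ a₁ b₁ K : ℝ}
    (hadm : ∀ N, 0 < N → Admissible N p (σ N) V ρ a₀ b₀ a₁ b₁ K)
    {μ : ∀ N : ℕ, Measure (Config N)} [∀ N, IsProbabilityMeasure (μ N)]
    {Ω : ℕ → Type*} [∀ N, MeasurableSpace (Ω N)]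
    {P : ∀ N, Measure (Ω N)} [∀ N, IsProbabilityMeasure (P N)]
    {η : ∀ N, ℝ≥0 → Ω N → Config N}
    (hη : ∀ N, 0 < N → IsMarkovProcess (gen N p (σ N) V ρ a₀ b₀ a₁ b₁) (μ N) (P N) (η N))
    {D : ∀ N : ℕ, ℝ → Config N → ℝ} {A : ∀ N : ℕ, ℝ → Finset (Fin (N + 1))}
    {e : ∀ N : ℕ, Fin (N + 1)} {c B : ℝ} (hc : c ∈ Icc (0 : ℝ) 1) (hB : 0 ≤ B) {m : ℝ → ℝ}
    (hm : Tendsto (fun y => y * m y) (𝓝[>] 0) atTop)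
    (hD : ∀ᶠ y in 𝓝[>] (0 : ℝ), ∀ N : ℕ, 0 < N →
      (∀ ξ, D N y ξ = 1 / (y * N) * ∑ i ∈ insert (e N) (A N y), occ ξ i) ∧ e N ∉ A N y ∧
      A N y ⊆ interior N ∧ ((A N y).card : ℝ) ≤ y * N ∧ y * N - 1 ≤ (A N y).card ∧
      (∀ i ∈ A N y, m y ≤ V (((i : ℕ) : ℝ) / N)) ∧
      ∀ i ∈ A N y, |profile N ρ i - c| ≤ B * y)
    {t δ : ℝ} (ht : 0 < t) (hδ : 0 < δ) :
    Tendsto (fun y : ℝ => limsup (fun N : ℕ => P N {ω | δ <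
        |(∫ s in (0 : ℝ)..t, D N y (η N s.toNNReal ω)) - t * c|}) atTop) (𝓝[>] 0) (𝓝 0) := by
  set c₁ : ℝ := 1 + 2 * K + (a₀ + b₀ + a₁ + b₁) * (1 + K) with hc₁
  set l : ℝ := K + Real.log 2 with hl
  have hlim : Tendsto (fun y : ℝ => ENNReal.ofReal (t / δ ^ 2 *
      (4 * (t * (1 / 4 * (√(y * m y))⁻¹) + (√(y * m y))⁻¹ * (c₁ * t + l)) +
        2 * t * (B * y) ^ 2))) (𝓝[>] 0) (𝓝 0) := by
    have h1 : Tendsto (fun y : ℝ => (√(y * m y))⁻¹) (𝓝[>] 0) (𝓝 0) :=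
      tendsto_inv_atTop_zero.comp (Real.tendsto_sqrt_atTop.comp hm)
    have h2 : Tendsto (fun y : ℝ => y) (𝓝[>] 0) (𝓝 0) :=
      tendsto_nhdsWithin_of_tendsto_nhds tendsto_id
    have h3 := ((((h1.const_mul (1 / 4)).const_mul t).add (h1.mul_const (c₁ * t + l))).const_mul
      4).add (((h2.const_mul B).pow 2).const_mul (2 * t))
    have h4 := (ENNReal.continuous_ofReal.tendsto _).comp (h3.const_mul (t / δ ^ 2))
    simpa [Function.comp_def] using h4
  refine tendsto_of_tendsto_of_tendsto_of_le_of_le' tendsto_const_nhds hlim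
    (Eventually.of_forall fun _ => zero_le) ?_
  filter_upwards [hD, hm.eventually_gt_atTop 0, self_mem_nhdsWithin] with y hy hmy hy0
  replace hy0 : 0 < y := hy0
  have hM : 0 < m y := pos_of_mul_pos_right hmy hy0.le
  -- This is `θ`: the errors `1/θ` and `θ / (y * m y)` are then both of order `q⁻¹`.
  set q := √(y * m y) with hq
  have hq0 : 0 < q := Real.sqrt_pos.2 hmy
  have hq2 : q ^ 2 = y * m y := Real.sq_sqrt hmy.le
  have hN : Tendsto (fun N : ℕ => (1 : ℝ) / N) atTop (𝓝 0) := tendsto_one_div_atTop_nhds_zero_nat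
  have hF : Tendsto (fun N : ℕ => ENNReal.ofReal (t / δ ^ 2 *
      (4 * (t * (1 / y * (1 / N) + 1 / 4 * q⁻¹) +
        q⁻¹ * ((c₁ + 2 * K ^ 2 * (σ N / N)) * t + (1 + 1 / N) * l)) +
        2 * t * (B * y + 2 / y * (1 / N)) ^ 2))) atTop
      (𝓝 (ENNReal.ofReal (t / δ ^ 2 * (4 * (t * (1 / 4 * q⁻¹) + q⁻¹ * (c₁ * t + l)) +
        2 * t * (B * y) ^ 2)))) := by
    have h1 := ((hN.const_mul (1 / y)).add_const (1 / 4 * q⁻¹)).const_mul t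
    have h2 := ((((hσ_N.const_mul (2 * K ^ 2)).const_add c₁).mul_const t).add
      ((hN.const_add 1).mul_const l)).const_mul q⁻¹
    have h3 := ((((hN.const_mul (2 / y)).const_add (B * y)).pow 2).const_mul (2 * t))
    have h4 := (((h1.add h2).const_mul 4).add h3).const_mul (t / δ ^ 2)
    have h5 := (ENNReal.continuous_ofReal.tendsto _).comp h4
    simpa [Function.comp_def] using h5
  rw [← hF.limsup_eq]
  refine limsup_le_limsup ?_
  filter_upwards [eventually_gt_atTop 0] with N hN0
  obtain ⟨h1, h2, h3, h4, h5, h6, h7⟩ := hy N hN0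
  have hN' : (0 : ℝ) < N := by exact_mod_cast hN0
  simp only [h1]
  refine (measure_density_le (hadm N hN0) (hη N hN0) h3 h2 (by positivity) h4 h5 hc
    (by positivity) h7 hM h6 hq0 ht hδ).trans_eq ?_
  congr 2
  have h8 : q / (m y * (y * N)) = q⁻¹ / N := by
    rw [show m y * (y * N) = q ^ 2 * N by rw [hq2]; ring]
    field_simp
  rw [h8, productionConst, ← hc₁, ← hl]
  field_simp

/-! ### The reference profile -/

lemma abs_log_sub_log_le {a b r : ℝ} (hr : 0 < r) (ha : r ≤ a) (hb : r ≤ b) :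
    |Real.log a - Real.log b| ≤ |a - b| / r := by
  have key : ∀ {a b : ℝ}, r ≤ a → r ≤ b → Real.log a - Real.log b ≤ |a - b| / r := by
    intro a b ha hb
    have hb0 := hr.trans_le hb
    have h1 := mul_log_sub_log_le hb0 (hr.trans_le ha)
    calc Real.log a - Real.log b ≤ (a - b) / b := by
          rw [le_div_iff₀ hb0]; linarith
      _ ≤ |a - b| / b := by gcongr; exact le_abs_self _
      _ ≤ |a - b| / r := by gcongr
  rw [abs_le]
  have h1 := key ha hb
  have h2 := key hb ha
  rw [abs_sub_comm] at h2
  constructor <;> linarith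

lemma site_mem_Icc {N : ℕ} (i : Fin (N + 1)) : ((i : ℕ) : ℝ) / N ∈ Icc (0 : ℝ) 1 := by
  refine ⟨by positivity, div_le_one_of_le₀ ?_ (by positivity)⟩
  exact_mod_cast Nat.lt_succ_iff.1 i.2

lemma exists_lipschitz_profile {ρ : ℝ → ℝ} (hρ : ContDiffOn ℝ 1 ρ (Icc 0 1)) :
    ∃ B : ℝ, 0 ≤ B ∧ ∀ x ∈ Icc (0 : ℝ) 1, ∀ y ∈ Icc (0 : ℝ) 1, |ρ x - ρ y| ≤ B * |x - y| := by
  have h1 : ContinuousOn (derivWithin ρ (Icc 0 1)) (Icc 0 1) :=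
    hρ.continuousOn_derivWithin (uniqueDiffOn_Icc (by norm_num)) le_rfl
  obtain ⟨B, hB⟩ := isCompact_Icc.exists_bound_of_continuousOn h1
  have hB0 : 0 ≤ B := (norm_nonneg _).trans (hB 0 (by simp))
  refine ⟨B, hB0, fun x hx y hy => ?_⟩
  have := (convex_Icc (0 : ℝ) 1).norm_image_sub_le_of_norm_derivWithin_le
    (hρ.differentiableOn (by norm_num)) hB hy hx
  simpa using this

/-- By compactness `ρ` stays at a distance `r > 0` from `0` and `1`, so the logarithms are bounded
and Lipschitz along the profile. Neighbouring sites are `1/N` apart. -/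
lemma exists_log_profile_bound {ρ : ℝ → ℝ} (hρ : ContDiffOn ℝ 1 ρ (Icc 0 1))
    (hρ_mem : ∀ x ∈ Icc (0 : ℝ) 1, ρ x ∈ Ioo (0 : ℝ) 1) :
    ∃ K : ℝ, ∀ N : ℕ, 0 < N →
      (∀ i b, -K ≤ Real.log (siteProb (profile N ρ i) b)) ∧
      ∀ (i : Fin N) b, |Real.log (siteProb (profile N ρ i.castSucc) b) -
        Real.log (siteProb (profile N ρ i.succ) b)| ≤ K / N := by
  obtain ⟨B, hB0, hB⟩ := exists_lipschitz_profile hρ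
  have hne : (Icc (0 : ℝ) 1).Nonempty := ⟨0, by simp⟩
  obtain ⟨x, hx, hxmin⟩ := isCompact_Icc.exists_isMinOn hne hρ.continuousOn
  obtain ⟨z, hz, hzmax⟩ := isCompact_Icc.exists_isMaxOn hne hρ.continuousOn
  set r := min (ρ x) (1 - ρ z) with hr
  have hr0 : 0 < r := lt_min (hρ_mem x hx).1 (by linarith [(hρ_mem z hz).2])
  have hle : ∀ u ∈ Icc (0 : ℝ) 1, ∀ b, r ≤ siteProb (ρ u) b := by
    intro u hu b
    unfold siteProb
    split_ifs
    · exact (min_le_left _ _).trans (hxmin hu)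
    · exact (min_le_right _ _).trans (by linarith [show ρ u ≤ ρ z from hzmax hu])
  refine ⟨max (-Real.log r) (B / r), fun N hN => ⟨fun i b => ?_, fun i b => ?_⟩⟩
  · have h1 := Real.log_le_log hr0 (hle _ (site_mem_Icc i) b)
    have h2 := le_max_left (-Real.log r) (B / r)
    unfold profile
    linarith
  · have hN' : (0 : ℝ) < N := by exact_mod_cast hN
    have h1 := abs_log_sub_log_le hr0 (hle _ (site_mem_Icc i.castSucc) b)
      (hle _ (site_mem_Icc i.succ) b)
    refine h1.trans ?_
    have h2 : ∀ a a' : ℝ, |siteProb a b - siteProb a' b| = |a - a'| := by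
      intro a a'
      unfold siteProb
      split_ifs
      · rfl
      · rw [abs_sub_comm]
        congr 1
        ring
    have h3 := hB _ (site_mem_Icc i.castSucc) _ (site_mem_Icc i.succ)
    have h4 : |((i.castSucc : ℕ) : ℝ) / N - ((i.succ : ℕ) : ℝ) / N| = 1 / N := by
      rw [← sub_div, Fin.val_castSucc, Fin.val_succ, abs_div, abs_of_pos hN']
      push_cast
      norm_num
    rw [h4] at h3
    rw [h2]
    calc _ ≤ B * (1 / N) / r := by gcongr
      _ = B / r / N := by ring
      _ ≤ _ := by gcongr; exact le_max_right _ _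

/-! ### The two boundaries -/

/-- The sites `1 ≤ i ≤ k`. -/
def leftSites (N k : ℕ) : Finset (Fin (N + 1)) :=
  Finset.univ.filter fun i => 0 < (i : ℕ) ∧ (i : ℕ) ≤ k

/-- The sites `N - k ≤ i ≤ N - 1`. -/
def rightSites (N k : ℕ) : Finset (Fin (N + 1)) :=
  Finset.univ.filter fun i => (i : ℕ) < N ∧ N ≤ (i : ℕ) + k

lemma card_leftSites {N k : ℕ} (hk : k ≤ N) : (leftSites N k).card = k := by
  have : (leftSites N k).map Fin.valEmbedding = Finset.Ioc 0 k := by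
    ext j
    simp only [leftSites, Finset.mem_map, Finset.mem_filter, Finset.mem_univ, true_and,
      Fin.valEmbedding_apply, Finset.mem_Ioc]
    constructor
    · rintro ⟨i, hi, rfl⟩
      exact hi
    · intro hj
      exact ⟨⟨j, by omega⟩, hj, rfl⟩
  rw [← Finset.card_map Fin.valEmbedding, this]
  simp

lemma card_rightSites {N k : ℕ} (hk : k ≤ N) : (rightSites N k).card = k := by
  have : (rightSites N k).map Fin.valEmbedding = Finset.Ico (N - k) N := by
    ext j
    simp only [rightSites, Finset.mem_map, Finset.mem_filter, Finset.mem_univ, true_and,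
      Fin.valEmbedding_apply, Finset.mem_Ico]
    constructor
    · rintro ⟨i, hi, rfl⟩
      omega
    · intro hj
      exact ⟨⟨j, by omega⟩, by simp; omega, rfl⟩
  rw [← Finset.card_map Fin.valEmbedding, this, Nat.card_Ico]
  omega

lemma leftDensity_eq {N : ℕ} (y : ℝ) (ξ : Config N) :
    leftDensity y ξ = 1 / (y * N) * ∑ i ∈ insert 0 (leftSites N ⌊y * N⌋₊), occ ξ i := by
  unfold leftDensity
  congr 2
  ext i
  simp only [leftSites, Finset.mem_filter, Finset.mem_univ, true_and, Finset.mem_insert,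
    Fin.ext_iff, Fin.val_zero]
  omega

lemma rightDensity_eq {N : ℕ} (y : ℝ) (ξ : Config N) :
    rightDensity y ξ =
      1 / (y * N) * ∑ i ∈ insert (Fin.last N) (rightSites N ⌊y * N⌋₊), occ ξ i := by
  unfold rightDensity
  congr 2
  ext i
  simp only [rightSites, Finset.mem_filter, Finset.mem_univ, true_and, Finset.mem_insert,
    Fin.ext_iff, Fin.val_last]
  omega

/-- The counted sites can lie at distance exactly `y` from the boundary, outside the open interval
of the infimum. Taking the infimum over the interval of length `2 * y` covers them, at the price of
a factor `2`. -/
lemma tendsto_mul_comp_two_mul {f : ℝ → ℝ}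
    (hf : Tendsto (fun y => y * f y) (𝓝[>] 0) atTop) :
    Tendsto (fun y => y * f (2 * y)) (𝓝[>] 0) atTop := by
  have h1 : Tendsto (fun y : ℝ => 2 * y) (𝓝[>] 0) (𝓝[>] 0) := by
    refine tendsto_nhdsWithin_iff.2 ⟨?_, ?_⟩
    · have : Tendsto (fun y : ℝ => 2 * y) (𝓝 0) (𝓝 (2 * 0)) := tendsto_id.const_mul 2
      rw [mul_zero] at this
      exact tendsto_nhdsWithin_of_tendsto_nhds this
    · filter_upwards [self_mem_nhdsWithin] with y hy
      exact mul_pos two_pos (mem_Ioi.1 hy)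
  refine ((hf.comp h1).const_mul_atTop (by norm_num : (0 : ℝ) < 1 / 2)).congr fun y => ?_
  simp only [Function.comp_apply]
  ring

lemma sInf_image_le {V : ℝ → ℝ} (hV : ∀ x ∈ Ioo (0 : ℝ) 1, 0 < V x) {S : Set ℝ}
    (hS : S ⊆ Ioo 0 1) {x : ℝ} (hx : x ∈ S) : sInf (V '' S) ≤ V x := by
  refine csInf_le ⟨0, ?_⟩ (mem_image_of_mem V hx)
  rintro _ ⟨z, hz, rfl⟩
  exact (hV z (hS hz)).le

end

end OpenASEP

/-! ### Conclusion at the two boundaries. -/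

theorem proposition2p3
    -- parameters of the dynamics
    (p : ℝ) (hp : 1 / 2 < p) (hp' : p ≤ 1)
    (σ : ℕ → ℝ) (hσ : ∀ N, 0 ≤ σ N) (hσ_top : Tendsto σ atTop atTop)
    (hσ_N : Tendsto (fun N : ℕ => σ N / N) atTop (𝓝 0))
    (a₀ b₀ a₁ b₁ : ℝ) (ha₀ : 0 ≤ a₀) (hb₀ : 0 ≤ b₀) (ha₁ : 0 ≤ a₁) (hb₁ : 0 ≤ b₁)
    (V : ℝ → ℝ) (hV : ContDiffOn ℝ 1 V (Ioo 0 1)) (hV_pos : ∀ x ∈ Ioo (0 : ℝ) 1, 0 < V x)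
    (hV_zero : Tendsto V (𝓝[>] 0) atTop) (hV_one : Tendsto V (𝓝[<] 1) atTop)
    (ρ : ℝ → ℝ) (hρ : ContDiffOn ℝ 1 ρ (Icc 0 1))
    (hρ' : ∃ K : ℝ≥0, LipschitzOnWith K (derivWithin ρ (Icc 0 1)) (Icc 0 1))
    (hρ_mem : ∀ x ∈ Icc (0 : ℝ) 1, ρ x ∈ Ioo (0 : ℝ) 1)
    -- the processes, with arbitrary initial distributions
    (μ : ∀ N : ℕ, Measure (OpenASEP.Config N)) [∀ N, IsProbabilityMeasure (μ N)]
    (Ω : ℕ → Type*) [∀ N, MeasurableSpace (Ω N)]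
    (P : ∀ N, Measure (Ω N)) [∀ N, IsProbabilityMeasure (P N)]
    (η : ∀ N, ℝ≥0 → Ω N → OpenASEP.Config N)
    (hη : ∀ N, 0 < N → OpenASEP.IsMarkovProcess
      (OpenASEP.gen N p (σ N) V ρ a₀ b₀ a₁ b₁) (μ N) (P N) (η N)) :
    -- the left boundary
    (Tendsto (fun y : ℝ => y * sInf (V '' Ioo 0 y)) (𝓝[>] 0) atTop →
      ∀ t : ℝ, 0 < t → ∀ δ : ℝ, 0 < δ →
        Tendsto (fun y : ℝ => limsup (fun N : ℕ => P N {ω | δ <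
            |(∫ s in (0 : ℝ)..t, OpenASEP.leftDensity y (η N s.toNNReal ω)) - t * ρ 0|}) atTop)
          (𝓝[>] 0) (𝓝 0)) ∧
    -- the right boundary
    (Tendsto (fun y : ℝ => y * sInf (V '' Ioo (1 - y) 1)) (𝓝[>] 0) atTop →
      ∀ t : ℝ, 0 < t → ∀ δ : ℝ, 0 < δ →
        Tendsto (fun y : ℝ => limsup (fun N : ℕ => P N {ω | δ <
            |(∫ s in (0 : ℝ)..t, OpenASEP.rightDensity y (η N s.toNNReal ω)) - t * ρ 1|}) atTop)
          (𝓝[>] 0) (𝓝 0)) := by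
  obtain ⟨K, hK⟩ := OpenASEP.exists_log_profile_bound hρ hρ_mem
  obtain ⟨B, hB0, hB⟩ := OpenASEP.exists_lipschitz_profile hρ
  have hint : ∀ N : ℕ, ∀ i ∈ OpenASEP.interior N, ((i : ℕ) : ℝ) / N ∈ Ioo (0 : ℝ) 1 := by
    intro N i hi
    simp only [OpenASEP.interior, Finset.mem_filter, Finset.mem_univ, true_and] at hi
    have hN : (0 : ℝ) < N := by exact_mod_cast hi.1.trans hi.2
    have h0 : (0 : ℝ) < (i : ℕ) := by exact_mod_cast hi.1
    have h1 : ((i : ℕ) : ℝ) < N := by exact_mod_cast hi.2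
    exact ⟨by positivity, (div_lt_one hN).2 h1⟩
  have hadm : ∀ N, 0 < N → OpenASEP.Admissible N p (σ N) V ρ a₀ b₀ a₁ b₁ K := fun N hN =>
    { size_pos := hN
      half_le := hp.le
      le_one := hp'
      sigma_nonneg := hσ N
      a₀_nonneg := ha₀
      b₀_nonneg := hb₀
      a₁_nonneg := ha₁
      b₁_nonneg := hb₁
      profile_mem := fun i => hρ_mem _ (OpenASEP.site_mem_Icc i)
      V_nonneg := fun i hi => (hV_pos _ (hint N i hi)).le
      log_ge := (hK N hN).1
      log_sub_le := (hK N hN).2 }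
  -- For `y < 1/2` the interval of length `2 * y` stays inside `(0, 1)`, where `V` is positive, and
  -- the counted sites do not reach the opposite reservoir.
  have hsmall : ∀ᶠ y in 𝓝[>] (0 : ℝ), y ∈ Ioo (0 : ℝ) (1 / 2) := Ioo_mem_nhdsGT (by norm_num)
  have hfloor : ∀ y ∈ Ioo (0 : ℝ) (1 / 2), ∀ N : ℕ, 0 < N →
      ((⌊y * N⌋₊ : ℕ) : ℝ) ≤ y * N ∧ y * N < (⌊y * N⌋₊ : ℕ) + 1 ∧ ⌊y * N⌋₊ < N := by
    intro y hy N hN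
    have hN' : (0 : ℝ) < N := by exact_mod_cast hN
    have h1 := Nat.floor_le (mul_nonneg hy.1.le hN'.le)
    refine ⟨h1, Nat.lt_floor_add_one _, ?_⟩
    have : ((⌊y * N⌋₊ : ℕ) : ℝ) < N := h1.trans_lt (by nlinarith [hy.2])
    exact_mod_cast this
  constructor
  · intro hleft t ht δ hδ
    refine OpenASEP.tendsto_limsup_measure_density hσ_N hadm hη
      (D := fun N y => OpenASEP.leftDensity y)
      (A := fun N y => OpenASEP.leftSites N ⌊y * N⌋₊) (e := fun N => 0)
      (Ioo_subset_Icc_self (hρ_mem 0 (by simp))) hB0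
      (OpenASEP.tendsto_mul_comp_two_mul (f := fun y => sInf (V '' Ioo 0 y)) hleft) ?_ ht hδ
    filter_upwards [hsmall] with y hy N hN
    obtain ⟨hk1, hk2, hk3⟩ := hfloor y hy N hN
    have hN' : (0 : ℝ) < N := by exact_mod_cast hN
    have hsub : OpenASEP.leftSites N ⌊y * N⌋₊ ⊆ OpenASEP.interior N := by
      intro i hi
      simp only [OpenASEP.leftSites, OpenASEP.interior, Finset.mem_filter, Finset.mem_univ,
        true_and] at hi ⊢
      omega
    have hsite : ∀ i ∈ OpenASEP.leftSites N ⌊y * N⌋₊, ((i : ℕ) : ℝ) / N ≤ y := by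
      intro i hi
      simp only [OpenASEP.leftSites, Finset.mem_filter, Finset.mem_univ, true_and] at hi
      have : ((i : ℕ) : ℝ) ≤ (⌊y * N⌋₊ : ℕ) := by exact_mod_cast hi.2
      rw [div_le_iff₀ hN']
      linarith
    refine ⟨OpenASEP.leftDensity_eq y, by simp [OpenASEP.leftSites], hsub, ?_, ?_, ?_, ?_⟩
    · rw [OpenASEP.card_leftSites hk3.le]
      exact hk1
    · rw [OpenASEP.card_leftSites hk3.le]
      linarith
    · intro i hi
      refine OpenASEP.sInf_image_le hV_pos (Ioo_subset_Ioo le_rfl (by linarith [hy.2])) ?_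
      exact ⟨(hint N i (hsub hi)).1, (hsite i hi).trans_lt (by linarith [hy.1])⟩
    · intro i hi
      refine (hB _ (OpenASEP.site_mem_Icc i) 0 (by simp)).trans ?_
      rw [sub_zero, abs_of_nonneg (OpenASEP.site_mem_Icc i).1]
      exact mul_le_mul_of_nonneg_left (hsite i hi) hB0
  · intro hright t ht δ hδ
    refine OpenASEP.tendsto_limsup_measure_density hσ_N hadm hη
      (D := fun N y => OpenASEP.rightDensity y)
      (A := fun N y => OpenASEP.rightSites N ⌊y * N⌋₊) (e := fun N => Fin.last N)
      (Ioo_subset_Icc_self (hρ_mem 1 (by simp))) hB0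
      (OpenASEP.tendsto_mul_comp_two_mul (f := fun y => sInf (V '' Ioo (1 - y) 1)) hright)
      ?_ ht hδ
    filter_upwards [hsmall] with y hy N hN
    obtain ⟨hk1, hk2, hk3⟩ := hfloor y hy N hN
    have hN' : (0 : ℝ) < N := by exact_mod_cast hN
    have hsub : OpenASEP.rightSites N ⌊y * N⌋₊ ⊆ OpenASEP.interior N := by
      intro i hi
      simp only [OpenASEP.rightSites, OpenASEP.interior, Finset.mem_filter, Finset.mem_univ,
        true_and] at hi ⊢
      omega
    have hsite : ∀ i ∈ OpenASEP.rightSites N ⌊y * N⌋₊, 1 - y ≤ ((i : ℕ) : ℝ) / N := by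
      intro i hi
      simp only [OpenASEP.rightSites, Finset.mem_filter, Finset.mem_univ, true_and] at hi
      have : (N : ℝ) ≤ (i : ℕ) + (⌊y * N⌋₊ : ℕ) := by exact_mod_cast hi.2
      rw [le_div_iff₀ hN']
      linarith
    refine ⟨OpenASEP.rightDensity_eq y, by simp [OpenASEP.rightSites], hsub, ?_, ?_, ?_, ?_⟩
    · rw [OpenASEP.card_rightSites hk3.le]
      exact hk1
    · rw [OpenASEP.card_rightSites hk3.le]
      linarith
    · intro i hi
      refine OpenASEP.sInf_image_le hV_pos (Ioo_subset_Ioo (by linarith [hy.2]) le_rfl) ?_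
      exact ⟨lt_of_lt_of_le (by linarith [hy.1]) (hsite i hi), (hint N i (hsub hi)).2⟩
    · intro i hi
      refine (hB _ (OpenASEP.site_mem_Icc i) 1 (by simp)).trans ?_
      rw [abs_sub_comm, abs_of_nonneg (sub_nonneg.2 (OpenASEP.site_mem_Icc i).2)]
      exact mul_le_mul_of_nonneg_left (by linarith [hsite i hi]) hB0
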